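/- **Theorem 3.1.** Let $N,M\ge 1$. For $I=(I_1,\dots,I_N)$ and $J=(J_1,\dots,J_M)$ let $\mathbb H^{I(N)\times J(M)}$ be the set of real-quaternion tensors with entries $d_{i_1\dots i_Nj_1\dots j_M}$, $1\le i_s\le I_s$, $1\le j_s\le J_s$. Juxtaposition denotes the Einstein product (summation over all multi-indices in the middle), $^*$ the conjugate transpose, $\mathcal I$ a unit tensor, $D^\dagger$ the Moore–Penrose inverse (the unique $X$ with $DXD=D$, $XDX=X$, $(DX)^*=DX$, $(XD)^*=XD$), and $\mathcal L_D=\mathcal I-D^\dagger D$, $\mathcal R_D=\mathcal I-DD^\dagger$. For $C\in\mathbb H^{I(N)\times J(M)}$, $D\in\mathbb H^{I(N)\times K(M)}$ the row block tensor $[C\ \ D]\in\mathbb H^{I(N)\times(J+K)(M)}$ equals $C$ at the column multi-indices with $l_s\le J_s$ for all $s$, equals $D$ (shifted by $J$) at those with $l_s>J_s$ for all $s$, and is $0$ at all others; the column block tensor $\begin{bmatrix}A\\B\end{bmatrix}$ is defined in the same way on row multi-indices. Consider, for $i=1,2,3$, the system $$\begin{cases}F_4Z_1G_4=E_4,\\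 A_iX_iB_i+C_iY_iD_i+C_i(F_iZ_iG_i+H_iZ_{i+1}J_i)B_i=E_i,\\ H_4Z_4J_4=E_5,\end{cases}\tag{1.3}$$ with given quaternion tensors of arbitrary compatible sizes (tensors acting from the left, $A_i,C_i,F_j,H_j$, have row and column multi-indices of order $N$; those acting from the right, $B_i,D_i,G_j,J_j$, of order $M$) and unknowns $X_i,Y_i$ ($i=1,2,3$), $Z_1,\dots,Z_4$. **Abbreviations.** For tensors $A,B,C,D,E$ for which $AXB+CYD=E$ makes sense, put $M=\mathcal R_AC$, $N=D\mathcal L_B$, $S=C\mathcal L_M$ and $$\begin{aligned} \mathsf x(A,B,C,D,E)&=A^\dagger EB^\dagger-A^\dagger CM^\dagger EB^\dagger-A^\dagger SC^\dagger EN^\dagger DB^\dagger,\\ \mathsf y(A,B,C,D,E)&=M^\dagger ED^\dagger+S^\dagger SC^\dagger EN^\dagger,\\ \mathsf X(A,B,C,D,E;U_2,U_4,U_5)&=\mathsf x(A,B,C,D,E)-A^\dagger SU_2\mathcal R_NDB^\dagger+\mathcal L_AU_4+U_5\mathcal R_B,\\ \mathsf Y(A,B,C,D,E;U_1,U_2,U_3)&=\mathsf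 y(A,B,C,D,E)+\mathcal L_M\mathcal L_SU_1+\mathcal L_MU_2\mathcal R_N+U_3\mathcal R_D. \end{aligned}$$ Let $\mathsf C_2(A,B,C,D,E)$ be the conditions $\mathcal R_M\mathcal R_AE=0$, $E\mathcal L_B\mathcal L_N=0$, $\mathcal R_AE\mathcal L_D=0$, $\mathcal R_CE\mathcal L_B=0$, and $\mathsf C_1(A,B,E)$ the conditions $\mathcal R_AE=0$, $E\mathcal L_B=0$. Put $\mathsf z(A,B,E)=A^\dagger EB^\dagger$ and $\mathsf Z(A,B,E;V,W)=A^\dagger EB^\dagger+\mathcal L_AV+W\mathcal R_B$. For block tensors $A$ (row) and $D$ (column) and arbitrary $V,W,T$ write $$(w_1,w_2,w_3,w_4)=\mathsf{Bl}(A,D,E)$$ for $$\begin{aligned}w_1&=[\mathcal I\ \ 0]\,(A^\dagger E-VD+\mathcal L_AW),& w_2&=[0\ \ \mathcal I]\,(A^\dagger E-VD+\mathcal L_AW),\\ w_3&=(\mathcal R_AED^\dagger+AV+T\mathcal R_D)\begin{bmatrix}\mathcal I\\0\end{bmatrix},& w_4&=(\mathcal R_AED^\dagger+AV+T\mathcal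 R_D)\begin{bmatrix}0\\\mathcal I\end{bmatrix};\end{aligned}$$ each use of $\mathsf{Bl}$ below has its own arbitrary $V,W,T$. **Auxiliary tensors.** For $i=1,2,3$: $$\begin{gathered}M_i=\mathcal R_{A_i}C_i,\quad N_i=D_i\mathcal L_{B_i},\quad S_i=C_i\mathcal L_{M_i},\quad \hat A_i=M_iF_i,\quad \hat C_i=M_iH_i,\quad \hat B_i=G_iB_i\mathcal L_{D_i},\quad \hat D_i=J_iB_i\mathcal L_{D_i},\\ \hat E_i=\mathcal R_{A_i}E_i\mathcal L_{D_i},\quad \hat M_i=\mathcal R_{\hat A_i}\hat C_i,\quad \hat N_i=\hat D_i\mathcal L_{\hat B_i},\quad \hat S_i=\hat C_i\mathcal L_{\hat M_i}.\end{gathered}$$ Write $\hat{\mathbf e}_i=(\hat A_i,\hat B_i,\hat C_i,\hat D_i,\hat E_i)$. (a) $A_{11}=[\mathcal L_{F_4}\ \ -\mathcal L_{\hat A_1}]$, $D_{11}=\begin{bmatrix}\mathcal R_{G_4}\\-\mathcal R_{\hat B_1}\end{bmatrix}$, $\hat A_{11}=\hat A_1^\dagger\hat S_1$, $\hat B_{11}=\mathcal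 R_{\hat N_1}\hat D_1\hat B_1^\dagger$, $E_{11}=\mathsf x(\hat{\mathbf e}_1)-F_4^\dagger E_4G_4^\dagger$; $A_{22}=[\mathcal L_{H_4}\ \ -\mathcal L_{\hat M_3}\mathcal L_{\hat S_3}]$, $D_{22}=\begin{bmatrix}\mathcal R_{J_4}\\-\mathcal R_{\hat D_3}\end{bmatrix}$, $\hat A_{22}=-\mathcal L_{\hat M_3}$, $\hat B_{22}=\mathcal R_{\hat N_3}$, $E_{22}=\mathsf y(\hat{\mathbf e}_3)-H_4^\dagger E_5J_4^\dagger$; $\hat{\hat A}_{kk}=\mathcal R_{A_{kk}}\hat A_{kk}$, $\hat{\hat B}_{kk}=\hat B_{kk}\mathcal L_{D_{kk}}$, $\hat{\hat E}_{kk}=\mathcal R_{A_{kk}}E_{kk}\mathcal L_{D_{kk}}$ ($k=1,2$). (b) For $k=1,2$: $\bar A_k=[-\mathcal L_{\hat M_k}\mathcal L_{\hat S_k}\ \ \mathcal L_{\hat A_{k+1}}]$, $\bar B_k=\begin{bmatrix}-\mathcal R_{\hat D_k}\\\mathcal R_{\hat B_{k+1}}\end{bmatrix}$, $\bar F_k=\hat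 A_{k+1}^\dagger\hat S_{k+1}$, $\bar G_k=\mathcal R_{\hat N_{k+1}}\hat D_{k+1}\hat B_{k+1}^\dagger$, $\bar H_k=\mathcal L_{\hat M_k}$, $\bar J_k=\mathcal R_{\hat N_k}$, $\bar E_k=-\mathsf y(\hat{\mathbf e}_k)+\mathsf x(\hat{\mathbf e}_{k+1})$; $\bar F_{kk}=\mathcal R_{\bar A_k}\bar F_k$, $\bar G_{kk}=\bar G_k\mathcal L_{\bar B_k}$, $\bar H_{kk}=\mathcal R_{\bar A_k}\bar H_k$, $\bar J_{kk}=\bar J_k\mathcal L_{\bar B_k}$, $\bar E_{kk}=\mathcal R_{\bar A_k}\bar E_k\mathcal L_{\bar B_k}$, $\bar M_{kk}=\mathcal R_{\bar F_{kk}}\bar H_{kk}$, $\bar N_{kk}=\bar J_{kk}\mathcal L_{\bar G_{kk}}$, $\bar S_{kk}=\bar H_{kk}\mathcal L_{\bar M_{kk}}$. Write $\bar{\mathbf e}_k=(\bar F_{kk},\bar G_{kk},\bar H_{kk},\bar J_{kk},\bar E_{kk})$. (c) $\bar{\bar A}_1=[\mathcal L_{\bar F_{11}}\ \ -\mathcal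 L_{\bar M_{22}}\mathcal L_{\bar S_{22}}]$, $\bar{\bar B}_1=\begin{bmatrix}\mathcal R_{\bar G_{11}}\\-\mathcal R_{\bar J_{22}}\end{bmatrix}$, $\bar{\bar F}_1=\bar F_{11}^\dagger\bar S_{11}$, $\bar{\bar G}_1=\mathcal R_{\bar N_{11}}\bar J_{11}\bar G_{11}^\dagger$, $\bar{\bar H}_1=\mathcal L_{\bar M_{22}}$, $\bar{\bar J}_1=\mathcal R_{\bar N_{22}}$, $\bar{\bar E}_1=\mathsf x(\bar{\mathbf e}_1)-\mathsf y(\bar{\mathbf e}_2)$; $\bar{\bar F}_{11}=\mathcal R_{\bar{\bar A}_1}\bar{\bar F}_1$, $\bar{\bar G}_{11}=\bar{\bar G}_1\mathcal L_{\bar{\bar B}_1}$, $\bar{\bar H}_{11}=\mathcal R_{\bar{\bar A}_1}\bar{\bar H}_1$, $\bar{\bar J}_{11}=\bar{\bar J}_1\mathcal L_{\bar{\bar B}_1}$, $\bar{\bar E}_{11}=\mathcal R_{\bar{\bar A}_1}\bar{\bar E}_1\mathcal L_{\bar{\bar B}_1}$, $\bar{\bar M}_{11}=\mathcal R_{\bar{\bar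 F}_{11}}\bar{\bar H}_{11}$, $\bar{\bar N}_{11}=\bar{\bar J}_{11}\mathcal L_{\bar{\bar G}_{11}}$, $\bar{\bar S}_{11}=\bar{\bar H}_{11}\mathcal L_{\bar{\bar M}_{11}}$. Write $\bar{\bar{\mathbf e}}=(\bar{\bar F}_{11},\bar{\bar G}_{11},\bar{\bar H}_{11},\bar{\bar J}_{11},\bar{\bar E}_{11})$. (d) $\tilde A_1=[\mathcal L_{\bar M_{11}}\mathcal L_{\bar S_{11}}\ \ -\mathcal L_{\hat{\hat A}_{11}}]$, $\tilde B_1=\begin{bmatrix}\mathcal R_{\bar J_{11}}\\-\mathcal R_{\hat{\hat B}_{11}}\end{bmatrix}$, $\tilde C_1=\mathcal L_{\bar M_{11}}$, $\tilde D_1=\mathcal R_{\bar N_{11}}$, $\tilde E_1=\mathsf z(\hat{\hat A}_{11},\hat{\hat B}_{11},\hat{\hat E}_{11})-\mathsf y(\bar{\mathbf e}_1)$; $\tilde A_2=[\mathcal L_{\hat{\hat A}_{22}}\ \ -\mathcal L_{\bar F_{22}}]$, $\tilde B_2=\begin{bmatrix}\mathcal R_{\hat{\hat B}_{22}}\\-\mathcal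 R_{\bar G_{22}}\end{bmatrix}$, $\tilde C_2=\bar F_{22}^\dagger\bar S_{22}$, $\tilde D_2=\mathcal R_{\bar N_{22}}\bar J_{22}\bar G_{22}^\dagger$, $\tilde E_2=\mathsf x(\bar{\mathbf e}_2)-\mathsf z(\hat{\hat A}_{22},\hat{\hat B}_{22},\hat{\hat E}_{22})$; $\tilde C_{kk}=\mathcal R_{\tilde A_k}\tilde C_k$, $\tilde D_{kk}=\tilde D_k\mathcal L_{\tilde B_k}$, $\tilde E_{kk}=\mathcal R_{\tilde A_k}\tilde E_k\mathcal L_{\tilde B_k}$ ($k=1,2$). (e) $\tilde F_1=[\mathcal L_{\tilde C_{11}}\ \ -\mathcal L_{\bar{\bar F}_{11}}]$, $\tilde G_1=\begin{bmatrix}\mathcal R_{\tilde D_{11}}\\-\mathcal R_{\bar{\bar G}_{11}}\end{bmatrix}$, $\tilde H_1=\bar{\bar F}_{11}^\dagger\bar{\bar S}_{11}$, $\tilde J_1=\mathcal R_{\bar{\bar N}_{11}}\bar{\bar J}_{11}\bar{\bar G}_{11}^\dagger$, $\tilde{\tilde E}_1=\mathsf x(\bar{\bar{\mathbf e}})-\mathsf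 z(\tilde C_{11},\tilde D_{11},\tilde E_{11})$; $\tilde F_2=[\mathcal L_{\bar{\bar M}_{11}}\mathcal L_{\bar{\bar S}_{11}}\ \ -\mathcal L_{\tilde C_{22}}]$, $\tilde G_2=\begin{bmatrix}\mathcal R_{\bar{\bar J}_{11}}\\-\mathcal R_{\tilde D_{22}}\end{bmatrix}$, $\tilde H_2=\mathcal L_{\bar{\bar M}_{11}}$, $\tilde J_2=\mathcal R_{\bar{\bar N}_{11}}$, $\tilde{\tilde E}_2=\mathsf z(\tilde C_{22},\tilde D_{22},\tilde E_{22})-\mathsf y(\bar{\bar{\mathbf e}})$; $\tilde H_{kk}=\mathcal R_{\tilde F_k}\tilde H_k$, $\tilde J_{kk}=\tilde J_k\mathcal L_{\tilde G_k}$, $\tilde{\tilde E}_{kk}=\mathcal R_{\tilde F_k}\tilde{\tilde E}_k\mathcal L_{\tilde G_k}$ ($k=1,2$). (f) $\tilde A=[\mathcal L_{\tilde H_{11}}\ \ -\mathcal L_{\tilde H_{22}}]$, $\tilde B=\begin{bmatrix}\mathcal R_{\tilde J_{11}}\\-\mathcal R_{\tilde J_{22}}\end{bmatrix}$, $\tilde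 E=\mathsf z(\tilde H_{22},\tilde J_{22},\tilde{\tilde E}_{22})-\mathsf z(\tilde H_{11},\tilde J_{11},\tilde{\tilde E}_{11})$. **Consistency.** The system (1.3) has a solution if and only if all of the following hold ($i=1,2,3$; $k=1,2$): $$\begin{gathered}\mathcal R_{M_i}\mathcal R_{A_i}E_i=0,\quad E_i\mathcal L_{B_i}\mathcal L_{N_i}=0,\quad \mathcal R_{C_i}E_i\mathcal L_{B_i}=0,\quad \mathsf C_2(\hat{\mathbf e}_i),\\ \mathsf C_1(F_4,G_4,E_4),\quad \mathsf C_1(H_4,J_4,E_5),\quad \mathsf C_1(\hat{\hat A}_{kk},\hat{\hat B}_{kk},\hat{\hat E}_{kk}),\quad \mathsf C_2(\bar{\mathbf e}_k),\quad \mathsf C_2(\bar{\bar{\mathbf e}}),\\ \mathsf C_1(\tilde C_{kk},\tilde D_{kk},\tilde E_{kk}),\quad \mathsf C_1(\tilde H_{kk},\tilde J_{kk},\tilde{\tilde E}_{kk}),\quad \mathcal R_{\tilde A}\tilde E\mathcal L_{\tilde B}=0.\end{gathered}$$ **General solution.** Under these conditions, the solutions of (1.3) are exactly the tuples given by the following formulas,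 when the tensors $V,W,T$ in each of the ten uses of $\mathsf{Bl}$ and $U_{1i},\dots,U_{5i}$ ($i=1,2,3$) range over all quaternion tensors of the appropriate sizes: $$\begin{aligned} X_i&=\mathsf X(A_i,B_i,C_i,D_i,\dot E_i;U_{2i},U_{4i},U_{5i}),\qquad Y_i=\mathsf Y(A_i,B_i,C_i,D_i,\dot E_i;U_{1i},U_{2i},U_{3i}),\\ &\qquad\text{where } \dot E_i=E_i-C_i(F_iZ_iG_i+H_iZ_{i+1}J_i)B_i,\\ Z_1&=\mathsf Z(F_4,G_4,E_4;W_1,W_2)=\mathsf X(\hat{\mathbf e}_1;\hat U_2,\hat U_4,\hat U_5),\\ Z_2&=\mathsf Y(\hat{\mathbf e}_1;\hat U_1,\hat U_2,\hat U_3)=\mathsf X(\hat{\mathbf e}_2;\hat V_2,\hat V_4,\hat V_5),\\ Z_3&=\mathsf Y(\hat{\mathbf e}_2;\hat V_1,\hat V_2,\hat V_3)=\mathsf X(\hat{\mathbf e}_3;\hat K_2,\hat K_4,\hat K_5),\\ Z_4&=\mathsf Z(H_4,J_4,E_5;\hat W_1,W_3)=\mathsf Y(\hat{\mathbf e}_3;\hat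 K_1,\hat K_2,\hat K_3),\\ (W_1,\hat U_4,W_2,\hat U_5)&=\mathsf{Bl}(A_{11},D_{11},E_{11}-\hat A_{11}\hat U_2\hat B_{11}),\\ (\hat W_1,\hat K_1,W_3,\hat K_3)&=\mathsf{Bl}(A_{22},D_{22},E_{22}-\hat A_{22}\hat K_2\hat B_{22}),\\ (\hat U_1,\hat V_4,\hat U_3,\hat V_5)&=\mathsf{Bl}(\bar A_1,\bar B_1,-\bar E_1+\bar F_1\hat V_2\bar G_1+\bar H_1\hat U_2\bar J_1),\\ (\hat V_1,\hat K_4,\hat V_3,\hat K_5)&=\mathsf{Bl}(\bar A_2,\bar B_2,-\bar E_2+\bar F_2\hat K_2\bar G_2+\bar H_2\hat V_2\bar J_2),\\ \hat U_2&=\mathsf Z(\hat{\hat A}_{11},\hat{\hat B}_{11},\hat{\hat E}_{11};V_{77},V_{88})=\mathsf Y(\bar{\mathbf e}_1;Q_{44},P_{44},Q_{66}),\\ \hat V_2&=\mathsf X(\bar{\mathbf e}_1;P_{44},P_{55},P_{66})=\mathsf Y(\bar{\mathbf e}_2;Q_{77},Q_{55},Q_{88}),\\ \hat K_2&=\mathsf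 Z(\hat{\hat A}_{22},\hat{\hat B}_{22},\hat{\hat E}_{22};V_{99},W_{11})=\mathsf X(\bar{\mathbf e}_2;Q_{55},P_{77},P_{88}),\\ (P_{55},Q_{77},P_{66},Q_{88})&=\mathsf{Bl}(\bar{\bar A}_1,\bar{\bar B}_1,-\bar{\bar E}_1+\bar{\bar F}_1P_{44}\bar{\bar G}_1+\bar{\bar H}_1Q_{55}\bar{\bar J}_1),\\ (Q_{44},V_{77},Q_{66},V_{88})&=\mathsf{Bl}(\tilde A_1,\tilde B_1,\tilde E_1-\tilde C_1P_{44}\tilde D_1),\\ (V_{99},P_{77},W_{11},P_{88})&=\mathsf{Bl}(\tilde A_2,\tilde B_2,\tilde E_2-\tilde C_2Q_{55}\tilde D_2),\\ P_{44}&=\mathsf X(\bar{\bar{\mathbf e}};K_{44},K_{55},K_{66})=\mathsf Z(\tilde C_{11},\tilde D_{11},\tilde E_{11};W_{88},W_{99}),\\ Q_{55}&=\mathsf Y(\bar{\bar{\mathbf e}};K_{77},K_{44},K_{88})=\mathsf Z(\tilde C_{22},\tilde D_{22},\tilde E_{22};T_{11},T_{22}),\\ (W_{88},K_{55},W_{99},K_{66})&=\mathsf{Bl}(\tilde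 F_1,\tilde G_1,\tilde{\tilde E}_1-\tilde H_1K_{44}\tilde J_1),\\ (K_{77},T_{11},K_{88},T_{22})&=\mathsf{Bl}(\tilde F_2,\tilde G_2,\tilde{\tilde E}_2-\tilde H_2K_{44}\tilde J_2),\\ K_{44}&=\mathsf Z(\tilde H_{11},\tilde J_{11},\tilde{\tilde E}_{11};T_{33},T_{44})=\mathsf Z(\tilde H_{22},\tilde J_{22},\tilde{\tilde E}_{22};T_{55},T_{66}),\\ (T_{33},T_{55},T_{44},T_{66})&=\mathsf{Bl}(\tilde A,\tilde B,\tilde E). \end{aligned}$$ Where two expressions are given for a tensor, they agree for every choice of the arbitrary tensors. -/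

import Mathlib

open scoped Quaternion Matrix

namespace QT

/-! ## Quaternion tensors and the Einstein product -/

/-- Multi-indices `i₁ … i_N` with `i_s` ranging over `I s` values. -/
abbrev MultiIndex {N : ℕ} (I : Fin N → ℕ) : Type := ∀ s, Fin (I s)

/-- Quaternion tensors in `ℍ^{I(N) × J(M)}`. Being matrices indexed by multi-indices, they carry
Mathlib's addition, conjugate transpose `ᴴ`, unit tensor `1`, and product `*`; the latter sums over
all multi-indices in the middle, so it is the Einstein product (see `einstein_apply`). -/
abbrev QTensor {N M : ℕ} (I : Fin N → ℕ) (J : Fin M → ℕ) : Type :=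
  Matrix (MultiIndex I) (MultiIndex J) ℍ[ℝ]

theorem einstein_apply {N M P : ℕ} {I : Fin N → ℕ} {J : Fin M → ℕ} {K : Fin P → ℕ}
    (A : QTensor I J) (B : QTensor J K) (i : MultiIndex I) (k : MultiIndex K) :
    (A * B) i k = ∑ j : MultiIndex J, A i j * B j k := rfl

/-! ## The Moore–Penrose inverse -/

/-- The four Penrose equations. -/
structure IsMoorePenrose {N M : ℕ} {I : Fin N → ℕ} {J : Fin M → ℕ}
    (D : QTensor I J) (X : QTensor J I) : Prop where
  mul_mul_self : D * X * D = D
  self_mul_mul : X * D * X = X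
  left_hermitian : (D * X)ᴴ = D * X
  right_hermitian : (X * D)ᴴ = X * D

theorem eq_zero_of_conjTranspose_mul_self {N M : ℕ} {I : Fin N → ℕ} {J : Fin M → ℕ}
    (B : QTensor I J) (h : Bᴴ * B = 0) : B = 0 := by
  ext1 i j
  have h1 : (Bᴴ * B) j j = 0 := by rw [h]; rfl
  rw [Matrix.mul_apply] at h1
  simp only [Matrix.conjTranspose_apply, Quaternion.star_mul_self] at h1
  have h2 : ∑ x, Quaternion.normSq (B x j) = 0 := by
    have h4 : algebraMap ℝ ℍ[ℝ] (∑ x, Quaternion.normSq (B x j)) = 0 := by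
      rw [map_sum]
      exact h1
    exact (map_eq_zero (algebraMap ℝ ℍ[ℝ])).1 h4
  have h3 := (Finset.sum_eq_zero_iff_of_nonneg
    (fun x _ => Quaternion.normSq_nonneg)).1 h2 i (Finset.mem_univ i)
  exact Quaternion.normSq_eq_zero.1 h3

theorem exists_sq_mul_of_isHermitian {M : ℕ} {J : Fin M → ℕ} (A : QTensor J J) (hA : Aᴴ = A) :
    ∃ c : QTensor J J, A * A * c = A := by
  have hdis : ∀ v : QTensor J J, A * (A * v) = 0 → A * v = 0 := by
    intro v hv
    apply eq_zero_of_conjTranspose_mul_self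
    rw [Matrix.conjTranspose_mul, hA, Matrix.mul_assoc, hv, Matrix.mul_zero]
  let f : QTensor J J →ₗ[ℝ] QTensor J J := LinearMap.mulLeft ℝ A
  let g : LinearMap.range f →ₗ[ℝ] LinearMap.range f :=
    f.restrict (fun x _ => LinearMap.mem_range_self f x)
  have hg : Function.Injective g := by
    rw [injective_iff_map_eq_zero]
    rintro ⟨_, v, rfl⟩ hx
    have : f (f v) = 0 := congrArg Subtype.val hx
    exact Subtype.ext (hdis v this)
  obtain ⟨⟨_, v, rfl⟩, hx⟩ := (LinearMap.injective_iff_surjective.1 hg)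
    ⟨f 1, LinearMap.mem_range_self f 1⟩
  refine ⟨v, ?_⟩
  have : f (f v) = f 1 := congrArg Subtype.val hx
  simpa [f, Matrix.mul_assoc] using this

theorem exists_isMoorePenrose {N M : ℕ} {I : Fin N → ℕ} {J : Fin M → ℕ} (D : QTensor I J) :
    ∃ X : QTensor J I, IsMoorePenrose D X := by
  obtain ⟨A, hAdef⟩ : ∃ A : QTensor J J, A = Dᴴ * D := ⟨_, rfl⟩
  have hAH : Aᴴ = A := by simp [hAdef]
  obtain ⟨c, hc⟩ := exists_sq_mul_of_isHermitian A hAH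
  have hc' : cᴴ * A * A = A := by
    have := congrArg Matrix.conjTranspose hc
    simpa [hAH, Matrix.mul_assoc] using this
  have hP : cᴴ * A = A * c := by
    calc cᴴ * A = cᴴ * (A * A * c) := by rw [hc]
      _ = (cᴴ * A * A) * c := by simp only [Matrix.mul_assoc]
      _ = A * c := by rw [hc']
  have hPH : (A * c)ᴴ = A * c := by rw [Matrix.conjTranspose_mul, hAH, hP]
  obtain ⟨g, hg⟩ : ∃ g : QTensor J J, g = A * c * c := ⟨_, rfl⟩
  have hAg : A * g = A * c := by
    rw [hg, ← Matrix.mul_assoc, ← Matrix.mul_assoc, hc]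
  have hgH : gᴴ = g := by
    calc gᴴ = (cᴴ * A * c)ᴴ := by rw [hg, hP]
      _ = cᴴ * (A * c) := by
        rw [Matrix.conjTranspose_mul, Matrix.conjTranspose_mul, hAH,
          Matrix.conjTranspose_conjTranspose]
      _ = g := by rw [← Matrix.mul_assoc, hP, hg]
  have hgA : g * A = A * c := by
    have := congrArg Matrix.conjTranspose hAg
    rwa [Matrix.conjTranspose_mul, hgH, hAH, hPH] at this
  have hPP : A * c * (A * c) = A * c := by
    calc A * c * (A * c) = cᴴ * A * (A * c) := by rw [hP]
      _ = cᴴ * (A * A * c) := by simp only [Matrix.mul_assoc]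
      _ = A * c := by rw [hc, hP]
  have hPg : A * c * g = g := by rw [hg, ← Matrix.mul_assoc, hPP]
  have hAP : A * (A * c) = A := by rw [← Matrix.mul_assoc, hc]
  have hDP : D * (A * c) = D := by
    have h0 : D * (A * c) - D = 0 := by
      apply eq_zero_of_conjTranspose_mul_self
      have h5 : Dᴴ * (D * (A * c) - D) = 0 := by
        rw [Matrix.mul_sub, ← Matrix.mul_assoc, ← hAdef, hAP, sub_self]
      rw [Matrix.conjTranspose_sub, Matrix.conjTranspose_mul, hPH, Matrix.sub_mul,
        Matrix.mul_assoc, h5, Matrix.mul_zero, sub_self]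
    exact sub_eq_zero.1 h0
  refine ⟨g * Dᴴ, ⟨?_, ?_, ?_, ?_⟩⟩
  · rw [Matrix.mul_assoc, Matrix.mul_assoc, ← hAdef, hgA, hDP]
  · rw [Matrix.mul_assoc g, ← hAdef, hgA, ← Matrix.mul_assoc, hPg]
  · rw [Matrix.conjTranspose_mul, Matrix.conjTranspose_mul, Matrix.conjTranspose_conjTranspose, hgH,
      Matrix.mul_assoc]
  · rw [Matrix.mul_assoc, ← hAdef, hgA, hPH]

theorem IsMoorePenrose.unique {N M : ℕ} {I : Fin N → ℕ} {J : Fin M → ℕ} {D : QTensor I J}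
    {X Y : QTensor J I} (hX : IsMoorePenrose D X) (hY : IsMoorePenrose D Y) : X = Y := by
  have h1 : D * X = D * Y := by
    calc D * X = (D * Y * D * X)ᴴ := by rw [hY.mul_mul_self, hX.left_hermitian]
      _ = D * X * (D * Y) := by
        rw [Matrix.mul_assoc (D * Y), Matrix.conjTranspose_mul, hX.left_hermitian,
          hY.left_hermitian]
      _ = D * Y := by rw [← Matrix.mul_assoc, hX.mul_mul_self]
  have h2 : X * D = Y * D := by
    calc X * D = (X * (D * Y * D))ᴴ := by rw [hY.mul_mul_self, hX.right_hermitian]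
      _ = Y * D * (X * D) := by
        rw [Matrix.mul_assoc D, ← Matrix.mul_assoc X, Matrix.conjTranspose_mul,
          hX.right_hermitian, hY.right_hermitian]
      _ = Y * D := by rw [Matrix.mul_assoc, ← Matrix.mul_assoc D, hX.mul_mul_self]
  calc X = X * D * X := hX.self_mul_mul.symm
    _ = Y * (D * X) := by rw [h2, Matrix.mul_assoc]
    _ = Y := by rw [h1, ← Matrix.mul_assoc, hY.self_mul_mul]

/-- The Moore–Penrose inverse `D†`: the unique solution of the four Penrose equations. -/
noncomputable def mpInv {N M : ℕ} {I : Fin N → ℕ} {J : Fin M → ℕ} (D : QTensor I J) :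
    QTensor J I :=
  Classical.choose (exists_isMoorePenrose D)

postfix:max "†" => mpInv

theorem mpInv_spec {N M : ℕ} {I : Fin N → ℕ} {J : Fin M → ℕ} (D : QTensor I J) :
    IsMoorePenrose D D† :=
  Classical.choose_spec (exists_isMoorePenrose D)

/-- `𝓛_D = I - D† D`. -/
noncomputable def projL {N M : ℕ} {I : Fin N → ℕ} {J : Fin M → ℕ} (D : QTensor I J) :
    QTensor J J := 1 - D† * D

/-- `𝓡_D = I - D D†`. -/
noncomputable def projR {N M : ℕ} {I : Fin N → ℕ} {J : Fin M → ℕ} (D : QTensor I J) :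
    QTensor I I := 1 - D * D†

/-! ## Block tensors -/

/-- The row block tensor `[C D] ∈ ℍ^{I(N) × L(M)}` with `L s = J s + K s`: it is `C` on the
multi-indices all of whose entries lie in the first ranges, (shifted) `D` on the multi-indices all
of whose entries lie in the second ranges, and zero at the mixed multi-indices. -/
noncomputable def rowBlock {N M : ℕ} {I : Fin N → ℕ} {J K : Fin M → ℕ} (C : QTensor I J) (D : QTensor I K) :
    QTensor I (J + K) := fun i l =>
  if h : ∀ s, (l s : ℕ) < J s then C i (fun s => ⟨l s, h s⟩)
  else if h' : ∀ s, J s ≤ (l s : ℕ) then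
    D i (fun s => ⟨(l s : ℕ) - J s,
      Nat.sub_lt_left_of_lt_add (h' s) (l s).isLt⟩)
  else 0

/-- The column block tensor, the transposed construction. -/
noncomputable def colBlock {N M : ℕ} {J K : Fin M → ℕ} {I : Fin N → ℕ} (A : QTensor J I) (B : QTensor K I) :
    QTensor (J + K) I := fun l i =>
  if h : ∀ s, (l s : ℕ) < J s then A (fun s => ⟨l s, h s⟩) i
  else if h' : ∀ s, J s ≤ (l s : ℕ) then
    B (fun s => ⟨(l s : ℕ) - J s,
      Nat.sub_lt_left_of_lt_add (h' s) (l s).isLt⟩) i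
  else 0

/-! ## Recurrent expressions -/

section Expressions

variable {N M : ℕ} {I a c : Fin N → ℕ} {K b d : Fin M → ℕ}

/-- `𝓡_A E = 0` and `E 𝓛_B = 0`. -/
def OneTermCond (A : QTensor I a) (B : QTensor b K) (E : QTensor I K) : Prop :=
  projR A * E = 0 ∧ E * projL B = 0

/-- `A† E B†`. -/
noncomputable def oneTermPart (A : QTensor I a) (B : QTensor b K) (E : QTensor I K) :
    QTensor a b := A† * E * B†

/-- `A† E B† + 𝓛_A V + W 𝓡_B`. -/
noncomputable def oneTermSol (A : QTensor I a) (B : QTensor b K) (E : QTensor I K)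
    (V W : QTensor a b) : QTensor a b :=
  oneTermPart A B E + projL A * V + W * projR B

/-- `M = 𝓡_A C`. -/
noncomputable def opM (A : QTensor I a) (C : QTensor I c) : QTensor I c := projR A * C

/-- `N = D 𝓛_B`. -/
noncomputable def opN (B : QTensor b K) (D : QTensor d K) : QTensor d K := D * projL B

/-- `S = C 𝓛_M`. -/
noncomputable def opS (A : QTensor I a) (C : QTensor I c) : QTensor I c := C * projL (opM A C)

/-- `𝓡_M 𝓡_A E = 0`, `E 𝓛_B 𝓛_N = 0`, `𝓡_A E 𝓛_D = 0` and `𝓡_C E 𝓛_B = 0`. -/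
def TwoTermCond (A : QTensor I a) (B : QTensor b K) (C : QTensor I c) (D : QTensor d K)
    (E : QTensor I K) : Prop :=
  projR (opM A C) * projR A * E = 0 ∧ E * projL B * projL (opN B D) = 0 ∧
    projR A * E * projL D = 0 ∧ projR C * E * projL B = 0

/-- `A† E B† - A† C M† E B† - A† S C† E N† D B†`. -/
noncomputable def partX (A : QTensor I a) (B : QTensor b K) (C : QTensor I c) (D : QTensor d K)
    (E : QTensor I K) : QTensor a b :=
  A† * E * B† - A† * C * (opM A C)† * E * B†
    - A† * opS A C * C† * E * (opN B D)† * D * B†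

/-- `M† E D† + S† S C† E N†`. -/
noncomputable def partY (A : QTensor I a) (B : QTensor b K) (C : QTensor I c) (D : QTensor d K)
    (E : QTensor I K) : QTensor c d :=
  (opM A C)† * E * D† + (opS A C)† * opS A C * C† * E * (opN B D)†

/-- `A† E B† - A† C M† E B† - A† S C† E N† D B† - A† S U₂ 𝓡_N D B† + 𝓛_A U₄ + U₅ 𝓡_B`. -/
noncomputable def solX (A : QTensor I a) (B : QTensor b K) (C : QTensor I c) (D : QTensor d K)
    (E : QTensor I K) (U₂ : QTensor c d) (U₄ U₅ : QTensor a b) : QTensor a b :=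
  partX A B C D E - A† * opS A C * U₂ * projR (opN B D) * D * B†
    + projL A * U₄ + U₅ * projR B

/-- `M† E D† + S† S C† E N† + 𝓛_M 𝓛_S U₁ + 𝓛_M U₂ 𝓡_N + U₃ 𝓡_D`. -/
noncomputable def solY (A : QTensor I a) (B : QTensor b K) (C : QTensor I c) (D : QTensor d K)
    (E : QTensor I K) (U₁ U₂ U₃ : QTensor c d) : QTensor c d :=
  partY A B C D E + projL (opM A C) * projL (opS A C) * U₁
    + projL (opM A C) * U₂ * projR (opN B D) + U₃ * projR D

end Expressions

/-- Three arbitrary tensors, the parameters of one block formula. -/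
structure BlockFree {N M : ℕ} (p : Fin N → ℕ) (l : Fin M → ℕ) where
  V : QTensor (p + p) (l + l)
  W : QTensor (p + p) l
  T : QTensor p (l + l)

section Blocks

variable {N M : ℕ} {p : Fin N → ℕ} {l : Fin M → ℕ}

/-- `[I 0] (A† E - V D + 𝓛_A W)`. -/
noncomputable def blockTop (A : QTensor p (p + p)) (D : QTensor (l + l) l) (E : QTensor p l)
    (v : BlockFree p l) : QTensor p l :=
  rowBlock (1 : QTensor p p) (0 : QTensor p p) * (A† * E - v.V * D + projL A * v.W)

/-- `[0 I] (A† E - V D + 𝓛_A W)`. -/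
noncomputable def blockBot (A : QTensor p (p + p)) (D : QTensor (l + l) l) (E : QTensor p l)
    (v : BlockFree p l) : QTensor p l :=
  rowBlock (0 : QTensor p p) (1 : QTensor p p) * (A† * E - v.V * D + projL A * v.W)

/-- `(𝓡_A E D† + A V + T 𝓡_D) [I; 0]`. -/
noncomputable def blockLeft (A : QTensor p (p + p)) (D : QTensor (l + l) l) (E : QTensor p l)
    (v : BlockFree p l) : QTensor p l :=
  (projR A * E * D† + A * v.V + v.T * projR D) * colBlock (1 : QTensor l l) (0 : QTensor l l)

/-- `(𝓡_A E D† + A V + T 𝓡_D) [0; I]`. -/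
noncomputable def blockRight (A : QTensor p (p + p)) (D : QTensor (l + l) l) (E : QTensor p l)
    (v : BlockFree p l) : QTensor p l :=
  (projR A * E * D† + A * v.V + v.T * projR D) * colBlock (0 : QTensor l l) (1 : QTensor l l)

end Blocks

/-! ## The system -/

/-- The coefficients of
`A X B + C Y D + C (F Z G + H Z' J) B = E`. -/
structure Eqn {N M : ℕ} (I a c p p' : Fin N → ℕ) (K b d l l' : Fin M → ℕ) where
  A : QTensor I a
  B : QTensor b K
  C : QTensor I c
  D : QTensor d K
  F : QTensor c p
  G : QTensor l b
  H : QTensor c p'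
  J : QTensor l' b
  E : QTensor I K

namespace Eqn

variable {N M : ℕ} {I a c p p' : Fin N → ℕ} {K b d l l' : Fin M → ℕ}
  (e : Eqn I a c p p' K b d l l')

def Holds (X : QTensor a b) (Y : QTensor c d) (Z : QTensor p l) (Z' : QTensor p' l') : Prop :=
  e.A * X * e.B + e.C * Y * e.D + e.C * (e.F * Z * e.G + e.H * Z' * e.J) * e.B = e.E

/-- `Ė = E - C (F Z G + H Z' J) B`. -/
noncomputable def Edot (Z : QTensor p l) (Z' : QTensor p' l') : QTensor I K :=
  e.E - e.C * (e.F * Z * e.G + e.H * Z' * e.J) * e.B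

noncomputable def Mi : QTensor I c := opM e.A e.C
noncomputable def Ni : QTensor d K := opN e.B e.D
noncomputable def Si : QTensor I c := opS e.A e.C
noncomputable def Ahat : QTensor I p := e.Mi * e.F
noncomputable def Chat : QTensor I p' := e.Mi * e.H
noncomputable def Bhat : QTensor l K := e.G * e.B * projL e.D
noncomputable def Dhat : QTensor l' K := e.J * e.B * projL e.D
noncomputable def Ehat : QTensor I K := projR e.A * e.E * projL e.D
noncomputable def Mhat : QTensor I p' := opM e.Ahat e.Chat
noncomputable def Nhat : QTensor l' K := opN e.Bhat e.Dhat
noncomputable def Shat : QTensor I p' := opS e.Ahat e.Chat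

/-- The consistency conditions of a single equation. -/
def Cond : Prop :=
  projR e.Mi * projR e.A * e.E = 0 ∧ e.E * projL e.B * projL e.Ni = 0 ∧
    projR e.C * e.E * projL e.B = 0 ∧ TwoTermCond e.Ahat e.Bhat e.Chat e.Dhat e.Ehat

/-- The particular part, and the general expression, of the first (`Z`) and the second (`Z'`)
inner unknown of the equation. -/
noncomputable def partFst : QTensor p l := partX e.Ahat e.Bhat e.Chat e.Dhat e.Ehat
noncomputable def partSnd : QTensor p' l' := partY e.Ahat e.Bhat e.Chat e.Dhat e.Ehat
noncomputable def solFst (U₂ : QTensor p' l') (U₄ U₅ : QTensor p l) : QTensor p l :=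
  solX e.Ahat e.Bhat e.Chat e.Dhat e.Ehat U₂ U₄ U₅
noncomputable def solSnd (U₁ U₂ U₃ : QTensor p' l') : QTensor p' l' :=
  solY e.Ahat e.Bhat e.Chat e.Dhat e.Ehat U₁ U₂ U₃

end Eqn

/-- The sizes of the tensors in the system. -/
structure Sizes (N M : ℕ) where
  (I₁ I₂ I₃ I₄ I₅ : Fin N → ℕ)
  (K₁ K₂ K₃ K₄ K₅ : Fin M → ℕ)
  (a₁ a₂ a₃ c₁ c₂ c₃ p₁ p₂ p₃ p₄ : Fin N → ℕ)
  (b₁ b₂ b₃ d₁ d₂ d₃ l₁ l₂ l₃ l₄ : Fin M → ℕ)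

/-- The given tensors of the coupled system. -/
structure Sys {N M : ℕ} (n : Sizes N M) where
  e₁ : Eqn n.I₁ n.a₁ n.c₁ n.p₁ n.p₂ n.K₁ n.b₁ n.d₁ n.l₁ n.l₂
  e₂ : Eqn n.I₂ n.a₂ n.c₂ n.p₂ n.p₃ n.K₂ n.b₂ n.d₂ n.l₂ n.l₃
  e₃ : Eqn n.I₃ n.a₃ n.c₃ n.p₃ n.p₄ n.K₃ n.b₃ n.d₃ n.l₃ n.l₄
  F₄ : QTensor n.I₄ n.p₁
  G₄ : QTensor n.l₁ n.K₄
  E₄ : QTensor n.I₄ n.K₄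
  H₄ : QTensor n.I₅ n.p₄
  J₄ : QTensor n.l₄ n.K₅
  E₅ : QTensor n.I₅ n.K₅

/-- The ten unknown tensors. -/
structure Unknowns {N M : ℕ} (n : Sizes N M) where
  X₁ : QTensor n.a₁ n.b₁
  X₂ : QTensor n.a₂ n.b₂
  X₃ : QTensor n.a₃ n.b₃
  Y₁ : QTensor n.c₁ n.d₁
  Y₂ : QTensor n.c₂ n.d₂
  Y₃ : QTensor n.c₃ n.d₃
  Z₁ : QTensor n.p₁ n.l₁
  Z₂ : QTensor n.p₂ n.l₂
  Z₃ : QTensor n.p₃ n.l₃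
  Z₄ : QTensor n.p₄ n.l₄

/-- The five arbitrary tensors in the expressions of `X` and `Y`. -/
structure OuterFree {N M : ℕ} (a c : Fin N → ℕ) (b d : Fin M → ℕ) where
  U₁ : QTensor c d
  U₂ : QTensor c d
  U₃ : QTensor c d
  U₄ : QTensor a b
  U₅ : QTensor a b

/-- The arbitrary tensors of the general solution; a field `v_T` parametrizes the block formulas
by which two expressions of the tensor `T` are matched. -/
structure Free {N M : ℕ} (n : Sizes N M) where
  u₁ : OuterFree n.a₁ n.c₁ n.b₁ n.d₁
  u₂ : OuterFree n.a₂ n.c₂ n.b₂ n.d₂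
  u₃ : OuterFree n.a₃ n.c₃ n.b₃ n.d₃
  v_Z₁ : BlockFree n.p₁ n.l₁
  v_Z₂ : BlockFree n.p₂ n.l₂
  v_Z₃ : BlockFree n.p₃ n.l₃
  v_Z₄ : BlockFree n.p₄ n.l₄
  v_U₂ : BlockFree n.p₂ n.l₂
  v_V₂ : BlockFree n.p₃ n.l₃
  v_K₂ : BlockFree n.p₄ n.l₄
  v_P₄₄ : BlockFree n.p₂ n.l₂
  v_Q₅₅ : BlockFree n.p₃ n.l₃
  v_K₄₄ : BlockFree n.p₃ n.l₃

namespace Sys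

variable {N M : ℕ} {n : Sizes N M} (S : Sys n)

/-- `u` solves the coupled system. -/
def Solves (u : Unknowns n) : Prop :=
  S.F₄ * u.Z₁ * S.G₄ = S.E₄ ∧
  S.e₁.Holds u.X₁ u.Y₁ u.Z₁ u.Z₂ ∧
  S.e₂.Holds u.X₂ u.Y₂ u.Z₂ u.Z₃ ∧
  S.e₃.Holds u.X₃ u.Y₃ u.Z₃ u.Z₄ ∧
  S.H₄ * u.Z₄ * S.J₄ = S.E₅

/-! ### Auxiliary tensors: matching the expressions of `Z₁` and of `Z₄` -/

noncomputable def A₁₁ : QTensor n.p₁ (n.p₁ + n.p₁) := rowBlock (projL S.F₄) (-projL S.e₁.Ahat)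
noncomputable def D₁₁ : QTensor (n.l₁ + n.l₁) n.l₁ := colBlock (projR S.G₄) (-projR S.e₁.Bhat)
noncomputable def Ahat₁₁ : QTensor n.p₁ n.p₂ := S.e₁.Ahat† * S.e₁.Shat
noncomputable def Bhat₁₁ : QTensor n.l₂ n.l₁ := projR S.e₁.Nhat * S.e₁.Dhat * S.e₁.Bhat†
noncomputable def E₁₁ : QTensor n.p₁ n.l₁ := S.e₁.partFst - oneTermPart S.F₄ S.G₄ S.E₄

noncomputable def A₂₂ : QTensor n.p₄ (n.p₄ + n.p₄) :=
  rowBlock (projL S.H₄) (-(projL S.e₃.Mhat * projL S.e₃.Shat))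
noncomputable def D₂₂ : QTensor (n.l₄ + n.l₄) n.l₄ := colBlock (projR S.J₄) (-projR S.e₃.Dhat)
noncomputable def Ahat₂₂ : QTensor n.p₄ n.p₄ := -projL S.e₃.Mhat
noncomputable def Bhat₂₂ : QTensor n.l₄ n.l₄ := projR S.e₃.Nhat
noncomputable def E₂₂ : QTensor n.p₄ n.l₄ := S.e₃.partSnd - oneTermPart S.H₄ S.J₄ S.E₅

/-! The suffix `hh` stands for a double hat. -/

noncomputable def Ahh₁₁ : QTensor n.p₁ n.p₂ := projR S.A₁₁ * S.Ahat₁₁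
noncomputable def Bhh₁₁ : QTensor n.l₂ n.l₁ := S.Bhat₁₁ * projL S.D₁₁
noncomputable def Ehh₁₁ : QTensor n.p₁ n.l₁ := projR S.A₁₁ * S.E₁₁ * projL S.D₁₁
noncomputable def Ahh₂₂ : QTensor n.p₄ n.p₄ := projR S.A₂₂ * S.Ahat₂₂
noncomputable def Bhh₂₂ : QTensor n.l₄ n.l₄ := S.Bhat₂₂ * projL S.D₂₂
noncomputable def Ehh₂₂ : QTensor n.p₄ n.l₄ := projR S.A₂₂ * S.E₂₂ * projL S.D₂₂

/-! ### Matching the expressions of `Z₂` and of `Z₃` -/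

noncomputable def Abar₁ : QTensor n.p₂ (n.p₂ + n.p₂) :=
  rowBlock (-(projL S.e₁.Mhat * projL S.e₁.Shat)) (projL S.e₂.Ahat)
noncomputable def Bbar₁ : QTensor (n.l₂ + n.l₂) n.l₂ :=
  colBlock (-projR S.e₁.Dhat) (projR S.e₂.Bhat)
noncomputable def Fbar₁ : QTensor n.p₂ n.p₃ := S.e₂.Ahat† * S.e₂.Shat
noncomputable def Gbar₁ : QTensor n.l₃ n.l₂ := projR S.e₂.Nhat * S.e₂.Dhat * S.e₂.Bhat†
noncomputable def Hbar₁ : QTensor n.p₂ n.p₂ := projL S.e₁.Mhat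
noncomputable def Jbar₁ : QTensor n.l₂ n.l₂ := projR S.e₁.Nhat
noncomputable def Ebar₁ : QTensor n.p₂ n.l₂ := -S.e₁.partSnd + S.e₂.partFst

noncomputable def Abar₂ : QTensor n.p₃ (n.p₃ + n.p₃) :=
  rowBlock (-(projL S.e₂.Mhat * projL S.e₂.Shat)) (projL S.e₃.Ahat)
noncomputable def Bbar₂ : QTensor (n.l₃ + n.l₃) n.l₃ :=
  colBlock (-projR S.e₂.Dhat) (projR S.e₃.Bhat)
noncomputable def Fbar₂ : QTensor n.p₃ n.p₄ := S.e₃.Ahat† * S.e₃.Shat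
noncomputable def Gbar₂ : QTensor n.l₄ n.l₃ := projR S.e₃.Nhat * S.e₃.Dhat * S.e₃.Bhat†
noncomputable def Hbar₂ : QTensor n.p₃ n.p₃ := projL S.e₂.Mhat
noncomputable def Jbar₂ : QTensor n.l₃ n.l₃ := projR S.e₂.Nhat
noncomputable def Ebar₂ : QTensor n.p₃ n.l₃ := -S.e₂.partSnd + S.e₃.partFst

noncomputable def Fbar₁₁ : QTensor n.p₂ n.p₃ := projR S.Abar₁ * S.Fbar₁
noncomputable def Gbar₁₁ : QTensor n.l₃ n.l₂ := S.Gbar₁ * projL S.Bbar₁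
noncomputable def Hbar₁₁ : QTensor n.p₂ n.p₂ := projR S.Abar₁ * S.Hbar₁
noncomputable def Jbar₁₁ : QTensor n.l₂ n.l₂ := S.Jbar₁ * projL S.Bbar₁
noncomputable def Ebar₁₁ : QTensor n.p₂ n.l₂ := projR S.Abar₁ * S.Ebar₁ * projL S.Bbar₁
noncomputable def Mbar₁₁ : QTensor n.p₂ n.p₂ := opM S.Fbar₁₁ S.Hbar₁₁
noncomputable def Nbar₁₁ : QTensor n.l₂ n.l₂ := opN S.Gbar₁₁ S.Jbar₁₁
noncomputable def Sbar₁₁ : QTensor n.p₂ n.p₂ := opS S.Fbar₁₁ S.Hbar₁₁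

noncomputable def Fbar₂₂ : QTensor n.p₃ n.p₄ := projR S.Abar₂ * S.Fbar₂
noncomputable def Gbar₂₂ : QTensor n.l₄ n.l₃ := S.Gbar₂ * projL S.Bbar₂
noncomputable def Hbar₂₂ : QTensor n.p₃ n.p₃ := projR S.Abar₂ * S.Hbar₂
noncomputable def Jbar₂₂ : QTensor n.l₃ n.l₃ := S.Jbar₂ * projL S.Bbar₂
noncomputable def Ebar₂₂ : QTensor n.p₃ n.l₃ := projR S.Abar₂ * S.Ebar₂ * projL S.Bbar₂
noncomputable def Mbar₂₂ : QTensor n.p₃ n.p₃ := opM S.Fbar₂₂ S.Hbar₂₂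
noncomputable def Nbar₂₂ : QTensor n.l₃ n.l₃ := opN S.Gbar₂₂ S.Jbar₂₂
noncomputable def Sbar₂₂ : QTensor n.p₃ n.p₃ := opS S.Fbar₂₂ S.Hbar₂₂

/-! ### Matching the expressions of `V̂₂` (`dbar` stands for a double bar) -/

noncomputable def Adbar₁ : QTensor n.p₃ (n.p₃ + n.p₃) :=
  rowBlock (projL S.Fbar₁₁) (-(projL S.Mbar₂₂ * projL S.Sbar₂₂))
noncomputable def Bdbar₁ : QTensor (n.l₃ + n.l₃) n.l₃ :=
  colBlock (projR S.Gbar₁₁) (-projR S.Jbar₂₂)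
noncomputable def Fdbar₁ : QTensor n.p₃ n.p₂ := S.Fbar₁₁† * S.Sbar₁₁
noncomputable def Gdbar₁ : QTensor n.l₂ n.l₃ := projR S.Nbar₁₁ * S.Jbar₁₁ * S.Gbar₁₁†
noncomputable def Hdbar₁ : QTensor n.p₃ n.p₃ := projL S.Mbar₂₂
noncomputable def Jdbar₁ : QTensor n.l₃ n.l₃ := projR S.Nbar₂₂
noncomputable def Edbar₁ : QTensor n.p₃ n.l₃ :=
  partX S.Fbar₁₁ S.Gbar₁₁ S.Hbar₁₁ S.Jbar₁₁ S.Ebar₁₁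
    - partY S.Fbar₂₂ S.Gbar₂₂ S.Hbar₂₂ S.Jbar₂₂ S.Ebar₂₂

noncomputable def Fdbar₁₁ : QTensor n.p₃ n.p₂ := projR S.Adbar₁ * S.Fdbar₁
noncomputable def Gdbar₁₁ : QTensor n.l₂ n.l₃ := S.Gdbar₁ * projL S.Bdbar₁
noncomputable def Hdbar₁₁ : QTensor n.p₃ n.p₃ := projR S.Adbar₁ * S.Hdbar₁
noncomputable def Jdbar₁₁ : QTensor n.l₃ n.l₃ := S.Jdbar₁ * projL S.Bdbar₁
noncomputable def Edbar₁₁ : QTensor n.p₃ n.l₃ := projR S.Adbar₁ * S.Edbar₁ * projL S.Bdbar₁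
noncomputable def Mdbar₁₁ : QTensor n.p₃ n.p₃ := opM S.Fdbar₁₁ S.Hdbar₁₁
noncomputable def Ndbar₁₁ : QTensor n.l₃ n.l₃ := opN S.Gdbar₁₁ S.Jdbar₁₁
noncomputable def Sdbar₁₁ : QTensor n.p₃ n.p₃ := opS S.Fdbar₁₁ S.Hdbar₁₁

/-! ### Matching the expressions of `Û₂` and of `K̂₂` (`til` stands for a tilde) -/

noncomputable def Atil₁ : QTensor n.p₂ (n.p₂ + n.p₂) :=
  rowBlock (projL S.Mbar₁₁ * projL S.Sbar₁₁) (-projL S.Ahh₁₁)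
noncomputable def Btil₁ : QTensor (n.l₂ + n.l₂) n.l₂ :=
  colBlock (projR S.Jbar₁₁) (-projR S.Bhh₁₁)
noncomputable def Ctil₁ : QTensor n.p₂ n.p₂ := projL S.Mbar₁₁
noncomputable def Dtil₁ : QTensor n.l₂ n.l₂ := projR S.Nbar₁₁
noncomputable def Etil₁ : QTensor n.p₂ n.l₂ :=
  oneTermPart S.Ahh₁₁ S.Bhh₁₁ S.Ehh₁₁ - partY S.Fbar₁₁ S.Gbar₁₁ S.Hbar₁₁ S.Jbar₁₁ S.Ebar₁₁

noncomputable def Atil₂ : QTensor n.p₄ (n.p₄ + n.p₄) :=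
  rowBlock (projL S.Ahh₂₂) (-projL S.Fbar₂₂)
noncomputable def Btil₂ : QTensor (n.l₄ + n.l₄) n.l₄ :=
  colBlock (projR S.Bhh₂₂) (-projR S.Gbar₂₂)
noncomputable def Ctil₂ : QTensor n.p₄ n.p₃ := S.Fbar₂₂† * S.Sbar₂₂
noncomputable def Dtil₂ : QTensor n.l₃ n.l₄ := projR S.Nbar₂₂ * S.Jbar₂₂ * S.Gbar₂₂†
noncomputable def Etil₂ : QTensor n.p₄ n.l₄ :=
  partX S.Fbar₂₂ S.Gbar₂₂ S.Hbar₂₂ S.Jbar₂₂ S.Ebar₂₂ - oneTermPart S.Ahh₂₂ S.Bhh₂₂ S.Ehh₂₂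

noncomputable def Ctil₁₁ : QTensor n.p₂ n.p₂ := projR S.Atil₁ * S.Ctil₁
noncomputable def Dtil₁₁ : QTensor n.l₂ n.l₂ := S.Dtil₁ * projL S.Btil₁
noncomputable def Etil₁₁ : QTensor n.p₂ n.l₂ := projR S.Atil₁ * S.Etil₁ * projL S.Btil₁
noncomputable def Ctil₂₂ : QTensor n.p₄ n.p₃ := projR S.Atil₂ * S.Ctil₂
noncomputable def Dtil₂₂ : QTensor n.l₃ n.l₄ := S.Dtil₂ * projL S.Btil₂
noncomputable def Etil₂₂ : QTensor n.p₄ n.l₄ := projR S.Atil₂ * S.Etil₂ * projL S.Btil₂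

/-! ### Matching the expressions of `P₄₄` and of `Q₅₅` (`dtil` stands for a double tilde) -/

noncomputable def Ftil₁ : QTensor n.p₂ (n.p₂ + n.p₂) :=
  rowBlock (projL S.Ctil₁₁) (-projL S.Fdbar₁₁)
noncomputable def Gtil₁ : QTensor (n.l₂ + n.l₂) n.l₂ :=
  colBlock (projR S.Dtil₁₁) (-projR S.Gdbar₁₁)
noncomputable def Htil₁ : QTensor n.p₂ n.p₃ := S.Fdbar₁₁† * S.Sdbar₁₁
noncomputable def Jtil₁ : QTensor n.l₃ n.l₂ := projR S.Ndbar₁₁ * S.Jdbar₁₁ * S.Gdbar₁₁†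
noncomputable def Edtil₁ : QTensor n.p₂ n.l₂ :=
  partX S.Fdbar₁₁ S.Gdbar₁₁ S.Hdbar₁₁ S.Jdbar₁₁ S.Edbar₁₁
    - oneTermPart S.Ctil₁₁ S.Dtil₁₁ S.Etil₁₁

noncomputable def Ftil₂ : QTensor n.p₃ (n.p₃ + n.p₃) :=
  rowBlock (projL S.Mdbar₁₁ * projL S.Sdbar₁₁) (-projL S.Ctil₂₂)
noncomputable def Gtil₂ : QTensor (n.l₃ + n.l₃) n.l₃ :=
  colBlock (projR S.Jdbar₁₁) (-projR S.Dtil₂₂)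
noncomputable def Htil₂ : QTensor n.p₃ n.p₃ := projL S.Mdbar₁₁
noncomputable def Jtil₂ : QTensor n.l₃ n.l₃ := projR S.Ndbar₁₁
noncomputable def Edtil₂ : QTensor n.p₃ n.l₃ :=
  oneTermPart S.Ctil₂₂ S.Dtil₂₂ S.Etil₂₂
    - partY S.Fdbar₁₁ S.Gdbar₁₁ S.Hdbar₁₁ S.Jdbar₁₁ S.Edbar₁₁

noncomputable def Htil₁₁ : QTensor n.p₂ n.p₃ := projR S.Ftil₁ * S.Htil₁
noncomputable def Jtil₁₁ : QTensor n.l₃ n.l₂ := S.Jtil₁ * projL S.Gtil₁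
noncomputable def Edtil₁₁ : QTensor n.p₂ n.l₂ := projR S.Ftil₁ * S.Edtil₁ * projL S.Gtil₁
noncomputable def Htil₂₂ : QTensor n.p₃ n.p₃ := projR S.Ftil₂ * S.Htil₂
noncomputable def Jtil₂₂ : QTensor n.l₃ n.l₃ := S.Jtil₂ * projL S.Gtil₂
noncomputable def Edtil₂₂ : QTensor n.p₃ n.l₃ := projR S.Ftil₂ * S.Edtil₂ * projL S.Gtil₂

/-! ### Matching the expressions of `K₄₄` -/

noncomputable def Atil : QTensor n.p₃ (n.p₃ + n.p₃) :=
  rowBlock (projL S.Htil₁₁) (-projL S.Htil₂₂)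
noncomputable def Btil : QTensor (n.l₃ + n.l₃) n.l₃ :=
  colBlock (projR S.Jtil₁₁) (-projR S.Jtil₂₂)
noncomputable def Etil : QTensor n.p₃ n.l₃ :=
  oneTermPart S.Htil₂₂ S.Jtil₂₂ S.Edtil₂₂ - oneTermPart S.Htil₁₁ S.Jtil₁₁ S.Edtil₁₁

/-! ### The consistency conditions -/

def Conditions : Prop :=
  S.e₁.Cond ∧ S.e₂.Cond ∧ S.e₃.Cond ∧
  OneTermCond S.F₄ S.G₄ S.E₄ ∧ OneTermCond S.H₄ S.J₄ S.E₅ ∧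
  OneTermCond S.Ahh₁₁ S.Bhh₁₁ S.Ehh₁₁ ∧ OneTermCond S.Ahh₂₂ S.Bhh₂₂ S.Ehh₂₂ ∧
  TwoTermCond S.Fbar₁₁ S.Gbar₁₁ S.Hbar₁₁ S.Jbar₁₁ S.Ebar₁₁ ∧
  TwoTermCond S.Fbar₂₂ S.Gbar₂₂ S.Hbar₂₂ S.Jbar₂₂ S.Ebar₂₂ ∧
  TwoTermCond S.Fdbar₁₁ S.Gdbar₁₁ S.Hdbar₁₁ S.Jdbar₁₁ S.Edbar₁₁ ∧
  OneTermCond S.Ctil₁₁ S.Dtil₁₁ S.Etil₁₁ ∧ OneTermCond S.Ctil₂₂ S.Dtil₂₂ S.Etil₂₂ ∧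
  OneTermCond S.Htil₁₁ S.Jtil₁₁ S.Edtil₁₁ ∧ OneTermCond S.Htil₂₂ S.Jtil₂₂ S.Edtil₂₂ ∧
  projR S.Atil * S.Etil * projL S.Btil = 0

/-! ### The general solution

The tensors below depend on the arbitrary tensors collected in `f`. -/

section GeneralSolution

variable (f : Free n)

noncomputable def T₃₃ : QTensor n.p₃ n.l₃ := blockTop S.Atil S.Btil S.Etil f.v_K₄₄
noncomputable def T₅₅ : QTensor n.p₃ n.l₃ := blockBot S.Atil S.Btil S.Etil f.v_K₄₄
noncomputable def T₄₄ : QTensor n.p₃ n.l₃ := blockLeft S.Atil S.Btil S.Etil f.v_K₄₄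
noncomputable def T₆₆ : QTensor n.p₃ n.l₃ := blockRight S.Atil S.Btil S.Etil f.v_K₄₄

noncomputable def K₄₄ : QTensor n.p₃ n.l₃ :=
  oneTermSol S.Htil₁₁ S.Jtil₁₁ S.Edtil₁₁ (S.T₃₃ f) (S.T₄₄ f)
noncomputable def K₄₄' : QTensor n.p₃ n.l₃ :=
  oneTermSol S.Htil₂₂ S.Jtil₂₂ S.Edtil₂₂ (S.T₅₅ f) (S.T₆₆ f)

noncomputable def rhsP₄₄ : QTensor n.p₂ n.l₂ := S.Edtil₁ - S.Htil₁ * S.K₄₄ f * S.Jtil₁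
noncomputable def W₈₈ : QTensor n.p₂ n.l₂ := blockTop S.Ftil₁ S.Gtil₁ (S.rhsP₄₄ f) f.v_P₄₄
noncomputable def K₅₅ : QTensor n.p₂ n.l₂ := blockBot S.Ftil₁ S.Gtil₁ (S.rhsP₄₄ f) f.v_P₄₄
noncomputable def W₉₉ : QTensor n.p₂ n.l₂ := blockLeft S.Ftil₁ S.Gtil₁ (S.rhsP₄₄ f) f.v_P₄₄
noncomputable def K₆₆ : QTensor n.p₂ n.l₂ := blockRight S.Ftil₁ S.Gtil₁ (S.rhsP₄₄ f) f.v_P₄₄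

noncomputable def rhsQ₅₅ : QTensor n.p₃ n.l₃ := S.Edtil₂ - S.Htil₂ * S.K₄₄ f * S.Jtil₂
noncomputable def K₇₇ : QTensor n.p₃ n.l₃ := blockTop S.Ftil₂ S.Gtil₂ (S.rhsQ₅₅ f) f.v_Q₅₅
noncomputable def T₁₁ : QTensor n.p₃ n.l₃ := blockBot S.Ftil₂ S.Gtil₂ (S.rhsQ₅₅ f) f.v_Q₅₅
noncomputable def K₈₈ : QTensor n.p₃ n.l₃ := blockLeft S.Ftil₂ S.Gtil₂ (S.rhsQ₅₅ f) f.v_Q₅₅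
noncomputable def T₂₂ : QTensor n.p₃ n.l₃ := blockRight S.Ftil₂ S.Gtil₂ (S.rhsQ₅₅ f) f.v_Q₅₅

noncomputable def P₄₄ : QTensor n.p₂ n.l₂ :=
  solX S.Fdbar₁₁ S.Gdbar₁₁ S.Hdbar₁₁ S.Jdbar₁₁ S.Edbar₁₁ (S.K₄₄ f) (S.K₅₅ f) (S.K₆₆ f)
noncomputable def P₄₄' : QTensor n.p₂ n.l₂ :=
  oneTermSol S.Ctil₁₁ S.Dtil₁₁ S.Etil₁₁ (S.W₈₈ f) (S.W₉₉ f)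
noncomputable def Q₅₅ : QTensor n.p₃ n.l₃ :=
  solY S.Fdbar₁₁ S.Gdbar₁₁ S.Hdbar₁₁ S.Jdbar₁₁ S.Edbar₁₁ (S.K₇₇ f) (S.K₄₄ f) (S.K₈₈ f)
noncomputable def Q₅₅' : QTensor n.p₃ n.l₃ :=
  oneTermSol S.Ctil₂₂ S.Dtil₂₂ S.Etil₂₂ (S.T₁₁ f) (S.T₂₂ f)

noncomputable def rhsU₂ : QTensor n.p₂ n.l₂ := S.Etil₁ - S.Ctil₁ * S.P₄₄ f * S.Dtil₁
noncomputable def Q₄₄ : QTensor n.p₂ n.l₂ := blockTop S.Atil₁ S.Btil₁ (S.rhsU₂ f) f.v_U₂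
noncomputable def V₇₇ : QTensor n.p₂ n.l₂ := blockBot S.Atil₁ S.Btil₁ (S.rhsU₂ f) f.v_U₂
noncomputable def Q₆₆ : QTensor n.p₂ n.l₂ := blockLeft S.Atil₁ S.Btil₁ (S.rhsU₂ f) f.v_U₂
noncomputable def V₈₈ : QTensor n.p₂ n.l₂ := blockRight S.Atil₁ S.Btil₁ (S.rhsU₂ f) f.v_U₂

noncomputable def rhsK₂ : QTensor n.p₄ n.l₄ := S.Etil₂ - S.Ctil₂ * S.Q₅₅ f * S.Dtil₂
noncomputable def V₉₉ : QTensor n.p₄ n.l₄ := blockTop S.Atil₂ S.Btil₂ (S.rhsK₂ f) f.v_K₂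
noncomputable def P₇₇ : QTensor n.p₄ n.l₄ := blockBot S.Atil₂ S.Btil₂ (S.rhsK₂ f) f.v_K₂
noncomputable def W₁₁ : QTensor n.p₄ n.l₄ := blockLeft S.Atil₂ S.Btil₂ (S.rhsK₂ f) f.v_K₂
noncomputable def P₈₈ : QTensor n.p₄ n.l₄ := blockRight S.Atil₂ S.Btil₂ (S.rhsK₂ f) f.v_K₂

noncomputable def rhsV₂ : QTensor n.p₃ n.l₃ :=
  -S.Edbar₁ + S.Fdbar₁ * S.P₄₄ f * S.Gdbar₁ + S.Hdbar₁ * S.Q₅₅ f * S.Jdbar₁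
noncomputable def P₅₅ : QTensor n.p₃ n.l₃ := blockTop S.Adbar₁ S.Bdbar₁ (S.rhsV₂ f) f.v_V₂
noncomputable def Q₇₇ : QTensor n.p₃ n.l₃ := blockBot S.Adbar₁ S.Bdbar₁ (S.rhsV₂ f) f.v_V₂
noncomputable def P₆₆ : QTensor n.p₃ n.l₃ := blockLeft S.Adbar₁ S.Bdbar₁ (S.rhsV₂ f) f.v_V₂
noncomputable def Q₈₈ : QTensor n.p₃ n.l₃ := blockRight S.Adbar₁ S.Bdbar₁ (S.rhsV₂ f) f.v_V₂

noncomputable def Uhat₂ : QTensor n.p₂ n.l₂ :=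
  oneTermSol S.Ahh₁₁ S.Bhh₁₁ S.Ehh₁₁ (S.V₇₇ f) (S.V₈₈ f)
noncomputable def Uhat₂' : QTensor n.p₂ n.l₂ :=
  solY S.Fbar₁₁ S.Gbar₁₁ S.Hbar₁₁ S.Jbar₁₁ S.Ebar₁₁ (S.Q₄₄ f) (S.P₄₄ f) (S.Q₆₆ f)
noncomputable def Khat₂ : QTensor n.p₄ n.l₄ :=
  oneTermSol S.Ahh₂₂ S.Bhh₂₂ S.Ehh₂₂ (S.V₉₉ f) (S.W₁₁ f)
noncomputable def Khat₂' : QTensor n.p₄ n.l₄ :=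
  solX S.Fbar₂₂ S.Gbar₂₂ S.Hbar₂₂ S.Jbar₂₂ S.Ebar₂₂ (S.Q₅₅ f) (S.P₇₇ f) (S.P₈₈ f)
noncomputable def Vhat₂ : QTensor n.p₃ n.l₃ :=
  solX S.Fbar₁₁ S.Gbar₁₁ S.Hbar₁₁ S.Jbar₁₁ S.Ebar₁₁ (S.P₄₄ f) (S.P₅₅ f) (S.P₆₆ f)
noncomputable def Vhat₂' : QTensor n.p₃ n.l₃ :=
  solY S.Fbar₂₂ S.Gbar₂₂ S.Hbar₂₂ S.Jbar₂₂ S.Ebar₂₂ (S.Q₇₇ f) (S.Q₅₅ f) (S.Q₈₈ f)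

noncomputable def rhsZ₂ : QTensor n.p₂ n.l₂ :=
  -S.Ebar₁ + S.Fbar₁ * S.Vhat₂ f * S.Gbar₁ + S.Hbar₁ * S.Uhat₂ f * S.Jbar₁
noncomputable def Uhat₁ : QTensor n.p₂ n.l₂ := blockTop S.Abar₁ S.Bbar₁ (S.rhsZ₂ f) f.v_Z₂
noncomputable def Vhat₄ : QTensor n.p₂ n.l₂ := blockBot S.Abar₁ S.Bbar₁ (S.rhsZ₂ f) f.v_Z₂
noncomputable def Uhat₃ : QTensor n.p₂ n.l₂ := blockLeft S.Abar₁ S.Bbar₁ (S.rhsZ₂ f) f.v_Z₂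
noncomputable def Vhat₅ : QTensor n.p₂ n.l₂ := blockRight S.Abar₁ S.Bbar₁ (S.rhsZ₂ f) f.v_Z₂

noncomputable def rhsZ₃ : QTensor n.p₃ n.l₃ :=
  -S.Ebar₂ + S.Fbar₂ * S.Khat₂ f * S.Gbar₂ + S.Hbar₂ * S.Vhat₂ f * S.Jbar₂
noncomputable def Vhat₁ : QTensor n.p₃ n.l₃ := blockTop S.Abar₂ S.Bbar₂ (S.rhsZ₃ f) f.v_Z₃
noncomputable def Khat₄ : QTensor n.p₃ n.l₃ := blockBot S.Abar₂ S.Bbar₂ (S.rhsZ₃ f) f.v_Z₃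
noncomputable def Vhat₃ : QTensor n.p₃ n.l₃ := blockLeft S.Abar₂ S.Bbar₂ (S.rhsZ₃ f) f.v_Z₃
noncomputable def Khat₅ : QTensor n.p₃ n.l₃ := blockRight S.Abar₂ S.Bbar₂ (S.rhsZ₃ f) f.v_Z₃

noncomputable def rhsZ₁ : QTensor n.p₁ n.l₁ := S.E₁₁ - S.Ahat₁₁ * S.Uhat₂ f * S.Bhat₁₁
noncomputable def W₁ : QTensor n.p₁ n.l₁ := blockTop S.A₁₁ S.D₁₁ (S.rhsZ₁ f) f.v_Z₁
noncomputable def Uhat₄ : QTensor n.p₁ n.l₁ := blockBot S.A₁₁ S.D₁₁ (S.rhsZ₁ f) f.v_Z₁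
noncomputable def W₂ : QTensor n.p₁ n.l₁ := blockLeft S.A₁₁ S.D₁₁ (S.rhsZ₁ f) f.v_Z₁
noncomputable def Uhat₅ : QTensor n.p₁ n.l₁ := blockRight S.A₁₁ S.D₁₁ (S.rhsZ₁ f) f.v_Z₁

noncomputable def rhsZ₄ : QTensor n.p₄ n.l₄ := S.E₂₂ - S.Ahat₂₂ * S.Khat₂ f * S.Bhat₂₂
noncomputable def What₁ : QTensor n.p₄ n.l₄ := blockTop S.A₂₂ S.D₂₂ (S.rhsZ₄ f) f.v_Z₄
noncomputable def Khat₁ : QTensor n.p₄ n.l₄ := blockBot S.A₂₂ S.D₂₂ (S.rhsZ₄ f) f.v_Z₄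
noncomputable def W₃ : QTensor n.p₄ n.l₄ := blockLeft S.A₂₂ S.D₂₂ (S.rhsZ₄ f) f.v_Z₄
noncomputable def Khat₃ : QTensor n.p₄ n.l₄ := blockRight S.A₂₂ S.D₂₂ (S.rhsZ₄ f) f.v_Z₄

noncomputable def Z₁ : QTensor n.p₁ n.l₁ := oneTermSol S.F₄ S.G₄ S.E₄ (S.W₁ f) (S.W₂ f)
noncomputable def Z₁' : QTensor n.p₁ n.l₁ := S.e₁.solFst (S.Uhat₂ f) (S.Uhat₄ f) (S.Uhat₅ f)
noncomputable def Z₂ : QTensor n.p₂ n.l₂ := S.e₁.solSnd (S.Uhat₁ f) (S.Uhat₂ f) (S.Uhat₃ f)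
noncomputable def Z₂' : QTensor n.p₂ n.l₂ := S.e₂.solFst (S.Vhat₂ f) (S.Vhat₄ f) (S.Vhat₅ f)
noncomputable def Z₃ : QTensor n.p₃ n.l₃ := S.e₂.solSnd (S.Vhat₁ f) (S.Vhat₂ f) (S.Vhat₃ f)
noncomputable def Z₃' : QTensor n.p₃ n.l₃ := S.e₃.solFst (S.Khat₂ f) (S.Khat₄ f) (S.Khat₅ f)
noncomputable def Z₄ : QTensor n.p₄ n.l₄ := oneTermSol S.H₄ S.J₄ S.E₅ (S.What₁ f) (S.W₃ f)
noncomputable def Z₄' : QTensor n.p₄ n.l₄ := S.e₃.solSnd (S.Khat₁ f) (S.Khat₂ f) (S.Khat₃ f)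

/-- The tensors `X_i`, `Y_i`, `Z_j` given by the formulas. -/
noncomputable def sol : Unknowns n where
  X₁ := solX S.e₁.A S.e₁.B S.e₁.C S.e₁.D (S.e₁.Edot (S.Z₁ f) (S.Z₂ f)) f.u₁.U₂ f.u₁.U₄ f.u₁.U₅
  X₂ := solX S.e₂.A S.e₂.B S.e₂.C S.e₂.D (S.e₂.Edot (S.Z₂ f) (S.Z₃ f)) f.u₂.U₂ f.u₂.U₄ f.u₂.U₅
  X₃ := solX S.e₃.A S.e₃.B S.e₃.C S.e₃.D (S.e₃.Edot (S.Z₃ f) (S.Z₄ f)) f.u₃.U₂ f.u₃.U₄ f.u₃.U₅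
  Y₁ := solY S.e₁.A S.e₁.B S.e₁.C S.e₁.D (S.e₁.Edot (S.Z₁ f) (S.Z₂ f)) f.u₁.U₁ f.u₁.U₂ f.u₁.U₃
  Y₂ := solY S.e₂.A S.e₂.B S.e₂.C S.e₂.D (S.e₂.Edot (S.Z₂ f) (S.Z₃ f)) f.u₂.U₁ f.u₂.U₂ f.u₂.U₃
  Y₃ := solY S.e₃.A S.e₃.B S.e₃.C S.e₃.D (S.e₃.Edot (S.Z₃ f) (S.Z₄ f)) f.u₃.U₁ f.u₃.U₂ f.u₃.U₃
  Z₁ := S.Z₁ f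
  Z₂ := S.Z₂ f
  Z₃ := S.Z₃ f
  Z₄ := S.Z₄ f

/-- The alternative expressions (primed) agree with the chosen ones. -/
def AlternativesAgree : Prop :=
  S.Z₁' f = S.Z₁ f ∧ S.Z₂' f = S.Z₂ f ∧ S.Z₃' f = S.Z₃ f ∧ S.Z₄' f = S.Z₄ f ∧
  S.Uhat₂' f = S.Uhat₂ f ∧ S.Vhat₂' f = S.Vhat₂ f ∧ S.Khat₂' f = S.Khat₂ f ∧
  S.P₄₄' f = S.P₄₄ f ∧ S.Q₅₅' f = S.Q₅₅ f ∧ S.K₄₄' f = S.K₄₄ f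

end GeneralSolution

end Sys

end QT

/-!
Everything rests on one remark about linear equations in tensors: since `A A† A = A`, an equation
`A X B = E` is solvable iff `𝓡_A E = 0` and `E 𝓛_B = 0` (`oneTerm_iff`), and
`A X B + C Y D = E` reduces to such equations by multiplying with the projections `𝓡_A`, `𝓛_B`,
`𝓡_C`, `𝓛_D` (`twoTerm_iff`). Both come with a parametrization of all solutions.

If an unknown has two such parametrizations, equating them gives an equation
`P w₁ + Q w₂ + w₃ R + w₄ T = E'` for four of the parameters. With block tensors it reads
`A x + y D = E'`, which is solvable iff `𝓡_A E' 𝓛_D = 0`, and then has the block formulas as its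
general solution (`mul_add_mul_iff`, `block_iff`). Here `E'` still contains the parameters that
occur between two coefficients, and the condition `𝓡_A E' 𝓛_D = 0` is again an equation with one
or two terms for these (`block_iff_oneTerm`, `block_iff_twoTerm`).

For the coupled system, eliminating `X_i`, `Y_i` leaves a chain of equations for `Z₁, …, Z₄` in
which neighbouring equations share an unknown (`Eqn.holds_iff`). Equating the two expressions of
each `Z_j` leaves a chain for `Û₂`, `V̂₂`, `K̂₂`, which in turn leaves one for `P₄₄`, `Q₅₅`, and
finally two equations for `K₄₄` alone. Every step is an equivalence (`Sys.Z₁_eq_iff`, …,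
`Sys.K₄₄_eq_iff`). Descending the chain from a solution produces the conditions and the parameters
(`Sys.Solves.conditions_and_exists`); ascending it from the conditions shows that the formulas
agree and solve the system (`Sys.Conditions.agree_and_solves`).
-/

namespace QT

/-! ### Moore–Penrose projections -/

section MoorePenrose

variable {N M P : ℕ} {I : Fin N → ℕ} {J : Fin M → ℕ} {K : Fin P → ℕ}

theorem mul_mpInv_mul_self (D : QTensor I J) : D * (D† * D) = D := by
  rw [← Matrix.mul_assoc, (mpInv_spec D).mul_mul_self]

theorem mpInv_mul_mul_mpInv (D : QTensor I J) : D† * (D * D†) = D† := by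
  rw [← Matrix.mul_assoc, (mpInv_spec D).self_mul_mul]

theorem mul_mpInv_mul_cancel (D : QTensor I J) (X : QTensor J K) : D * (D† * (D * X)) = D * X := by
  rw [← Matrix.mul_assoc D†, ← Matrix.mul_assoc, mul_mpInv_mul_self]

theorem mul_projL_self (D : QTensor I J) : D * projL D = 0 := by
  rw [projL, Matrix.mul_sub, mul_mpInv_mul_self, Matrix.mul_one, sub_self]

theorem projR_mul_self (D : QTensor I J) : projR D * D = 0 := by
  rw [projR, Matrix.sub_mul, Matrix.mul_assoc, mul_mpInv_mul_self, Matrix.one_mul, sub_self]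

theorem mul_projL_cancel (D : QTensor I J) (X : QTensor J K) : D * (projL D * X) = 0 := by
  rw [← Matrix.mul_assoc, mul_projL_self, Matrix.zero_mul]

theorem projR_mul_cancel (D : QTensor I J) (X : QTensor J K) : projR D * (D * X) = 0 := by
  rw [← Matrix.mul_assoc, projR_mul_self, Matrix.zero_mul]

theorem conjTranspose_projL (D : QTensor I J) : (projL D)ᴴ = projL D := by
  rw [projL, Matrix.conjTranspose_sub, (mpInv_spec D).right_hermitian, Matrix.conjTranspose_one]

theorem conjTranspose_projR (D : QTensor I J) : (projR D)ᴴ = projR D := by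
  rw [projR, Matrix.conjTranspose_sub, (mpInv_spec D).left_hermitian, Matrix.conjTranspose_one]

/-- A Hermitian tensor that fixes `D` on the left fixes the range of `(D†)ᴴ`, which is the
range of `D`. -/
theorem mpInv_mul_of_mul_eq {D : QTensor I J} {P : QTensor I I} (hP : Pᴴ = P) (h : P * D = D) :
    D† * P = D† := by
  have h1 : D * D† * P = D * D† := by
    have := congrArg Matrix.conjTranspose
      (show P * (D * D†) = D * D† by rw [← Matrix.mul_assoc, h])
    rwa [Matrix.conjTranspose_mul, (mpInv_spec D).left_hermitian, hP] at this
  calc D† * P = D† * (D * D†) * P := by rw [mpInv_mul_mul_mpInv]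
    _ = D† * (D * D† * P) := by rw [Matrix.mul_assoc]
    _ = D† := by rw [h1, mpInv_mul_mul_mpInv]

/-- The mirror image of `mpInv_mul_of_mul_eq`. -/
theorem mul_mpInv_of_mul_eq {D : QTensor I J} {P : QTensor J J} (hP : Pᴴ = P) (h : D * P = D) :
    P * D† = D† := by
  have h1 : P * (D† * D) = D† * D := by
    have := congrArg Matrix.conjTranspose
      (show D† * D * P = D† * D by rw [Matrix.mul_assoc, h])
    rwa [Matrix.conjTranspose_mul, (mpInv_spec D).right_hermitian, hP] at this
  calc P * D† = P * (D† * (D * D†)) := by rw [mpInv_mul_mul_mpInv]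
    _ = P * (D† * D) * D† := by simp only [Matrix.mul_assoc]
    _ = D† := by rw [h1, Matrix.mul_assoc, mpInv_mul_mul_mpInv]

theorem projL_mul_projL (D : QTensor I J) : projL D * projL D = projL D := by
  have h := mul_projL_self D
  rw [projL] at h ⊢
  rw [Matrix.sub_mul, Matrix.mul_assoc, h, Matrix.one_mul, Matrix.mul_zero, sub_zero]

theorem projR_mul_projR (D : QTensor I J) : projR D * projR D = projR D := by
  have h := projR_mul_self D
  rw [projR] at h ⊢
  rw [Matrix.mul_sub, ← Matrix.mul_assoc, h, Matrix.mul_one, Matrix.zero_mul, sub_zero]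

theorem projR_mul_eq_zero_iff (D : QTensor I J) (X : QTensor I K) :
    projR D * X = 0 ↔ D * (D† * X) = X := by
  rw [projR, Matrix.sub_mul, Matrix.one_mul, sub_eq_zero, Matrix.mul_assoc, eq_comm]

theorem mul_projL_eq_zero_iff (D : QTensor I J) (X : QTensor K J) :
    X * projL D = 0 ↔ X * (D† * D) = X := by
  rw [projL, Matrix.mul_sub, Matrix.mul_one, sub_eq_zero, eq_comm]

end MoorePenrose

/-! ### The equations `A X B = E` and `A X B + C Y D = E` -/

section Equations

variable {N M : ℕ} {I a c : Fin N → ℕ} {K b d : Fin M → ℕ}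

/-- Solvability criterion and general solution of `A X B = E`. -/
theorem oneTerm_iff (A : QTensor I a) (B : QTensor b K) (E : QTensor I K) (X : QTensor a b) :
    A * X * B = E ↔ OneTermCond A B E ∧ ∃ V W, X = oneTermSol A B E V W := by
  constructor
  · rintro rfl
    refine ⟨⟨?_, ?_⟩, X, A† * A * X, ?_⟩
    · simp only [Matrix.mul_assoc, projR_mul_cancel]
    · simp only [Matrix.mul_assoc, mul_projL_self, Matrix.mul_zero]
    · simp only [oneTermSol, oneTermPart, projL, projR, Matrix.mul_assoc, Matrix.sub_mul,
        Matrix.mul_sub, Matrix.one_mul, Matrix.mul_one]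
      abel
  · rintro ⟨⟨h1, h2⟩, V, W, rfl⟩
    rw [projR_mul_eq_zero_iff] at h1
    rw [mul_projL_eq_zero_iff] at h2
    simp only [oneTermSol, oneTermPart, Matrix.mul_assoc, Matrix.add_mul,
        Matrix.mul_add, mul_projL_cancel, projR_mul_self, Matrix.mul_zero, add_zero, h2, h1]

variable (A : QTensor I a) (B : QTensor b K) (C : QTensor I c) (D : QTensor d K)

theorem opM_mpInv_mul_projR : (opM A C)† * projR A = (opM A C)† :=
  mpInv_mul_of_mul_eq (conjTranspose_projR A)
    (by rw [opM, ← Matrix.mul_assoc, projR_mul_projR])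

theorem projL_mul_opN_mpInv : projL B * (opN B D)† = (opN B D)† :=
  mul_mpInv_of_mul_eq (conjTranspose_projL B)
    (by rw [opN, Matrix.mul_assoc, projL_mul_projL])

theorem projL_mul_opS_mpInv : projL (opM A C) * (opS A C)† = (opS A C)† :=
  mul_mpInv_of_mul_eq (conjTranspose_projL _)
    (by rw [opS, Matrix.mul_assoc, projL_mul_projL])

theorem mul_mpInv_mul_opS : A * (A† * opS A C) = opS A C := by
  rw [← projR_mul_eq_zero_iff, opS, ← Matrix.mul_assoc]
  exact mul_projL_self (opM A C)

theorem mul_opS_mpInv_mul_opS : C * ((opS A C)† * opS A C) = opS A C := by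
  rw [← projL_mul_opS_mpInv, Matrix.mul_assoc, ← Matrix.mul_assoc C]
  exact mul_mpInv_mul_self (opS A C)

theorem opS_mul_mpInv_mul : opS A C * (C† * C) = opS A C := by
  have h : opM A C * (C† * C) = opM A C := by
    rw [opM, Matrix.mul_assoc, mul_mpInv_mul_self]
  rw [opS, projL, Matrix.mul_sub, Matrix.sub_mul, Matrix.mul_one, mul_mpInv_mul_self]
  simp only [Matrix.mul_assoc, h]

theorem twoTermCond_of_eq {E : QTensor I K} {X : QTensor a b} {Y : QTensor c d}
    (h : A * X * B + C * Y * D = E) : TwoTermCond A B C D E := by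
  subst h
  have hM (Z : QTensor c K) : projR A * (C * Z) = opM A C * Z := by rw [opM, Matrix.mul_assoc]
  refine ⟨?_, ?_, ?_, ?_⟩
  · simp only [Matrix.mul_add, Matrix.mul_assoc, projR_mul_cancel, hM, Matrix.mul_zero, add_zero]
  · have h1 : D * (projL B * projL (opN B D)) = 0 := by
      rw [← Matrix.mul_assoc]; exact mul_projL_self (opN B D)
    simp only [Matrix.add_mul, Matrix.mul_assoc, mul_projL_cancel, h1, Matrix.mul_zero, add_zero]
  · simp only [Matrix.mul_add, Matrix.add_mul, Matrix.mul_assoc, projR_mul_cancel, Matrix.zero_mul,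
      mul_projL_self, Matrix.mul_zero, add_zero]
  · simp only [Matrix.mul_add, Matrix.mul_assoc, projR_mul_cancel, mul_projL_self, Matrix.mul_zero,
      add_zero]

theorem opM_mpInv_mul_left {P : ℕ} {k : Fin P → ℕ} (Z : QTensor a k) :
    (opM A C)† * (A * Z) = 0 := by
  rw [← opM_mpInv_mul_projR, Matrix.mul_assoc, projR_mul_cancel, Matrix.mul_zero]

theorem opM_mpInv_mul_right {P : ℕ} {k : Fin P → ℕ} (Z : QTensor c k) :
    (opM A C)† * (C * Z) = (opM A C)† * (opM A C * Z) := by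
  conv_lhs => rw [← opM_mpInv_mul_projR, Matrix.mul_assoc, ← Matrix.mul_assoc (projR A), ← opM]

theorem left_mul_opN_mpInv : B * (opN B D)† = 0 := by
  rw [← projL_mul_opN_mpInv, mul_projL_cancel]

theorem right_mul_opN_mpInv : D * (opN B D)† = opN B D * (opN B D)† := by
  conv_lhs => rw [← projL_mul_opN_mpInv, ← Matrix.mul_assoc, ← opN]

theorem opM_mul_opS_mpInv : opM A C * (opS A C)† = 0 := by
  rw [← projL_mul_opS_mpInv, mul_projL_cancel]

/-- A given solution `(X, Y)` is recovered with the parameters `U₁ = Y`, `U₂ = S† S Y`,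
`U₃ = M† M Y`, `U₄ = X` and `U₅ = A† A X`. -/
theorem exists_sol_of_eq {E : QTensor I K} {X : QTensor a b} {Y : QTensor c d}
    (h : A * X * B + C * Y * D = E) :
    ∃ U₁ U₂ U₃ U₄ U₅, X = solX A B C D E U₂ U₄ U₅ ∧ Y = solY A B C D E U₁ U₂ U₃ := by
  subst h
  have m1 {P : ℕ} {k : Fin P → ℕ} (Z : QTensor a k) := opM_mpInv_mul_left A C Z
  have m2 {P : ℕ} {k : Fin P → ℕ} (Z : QTensor c k) := opM_mpInv_mul_right A C Z
  have n1 {P : ℕ} {k : Fin P → ℕ} (Z : QTensor d k) : B * ((opN B D)† * Z) = 0 := by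
    rw [← Matrix.mul_assoc, left_mul_opN_mpInv, Matrix.zero_mul]
  have n2 {P : ℕ} {k : Fin P → ℕ} (Z : QTensor d k) :
      D * ((opN B D)† * Z) = opN B D * ((opN B D)† * Z) := by
    rw [← Matrix.mul_assoc, right_mul_opN_mpInv, Matrix.mul_assoc]
  have s1 {P : ℕ} {k : Fin P → ℕ} (Z : QTensor c k) :
      opS A C * (C† * (C * Z)) = opS A C * Z := by
    rw [← Matrix.mul_assoc C†, ← Matrix.mul_assoc, opS_mul_mpInv_mul]
  have s2 {P : ℕ} {k : Fin P → ℕ} (Z : QTensor I k) :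
      opM A C * ((opS A C)† * Z) = 0 := by
    rw [← Matrix.mul_assoc, opM_mul_opS_mpInv, Matrix.zero_mul]
  have s3 : C * (Y * (D * B†))
      = C * ((opM A C)† * (opM A C * (Y * (D * B†)))) + opS A C * (Y * (D * B†)) := by
    simp only [opS, projL, Matrix.mul_sub, Matrix.sub_mul, Matrix.mul_assoc, Matrix.mul_one]
    abel
  refine ⟨Y, (opS A C)† * opS A C * Y, (opM A C)† * opM A C * Y, X, A† * A * X, ?_, ?_⟩
  · simp only [solX, partX, projL, projR, Matrix.mul_add, Matrix.add_mul, Matrix.mul_assoc, m1, m2,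
      n1, n2, s1, mul_mpInv_mul_cancel, Matrix.mul_sub, Matrix.sub_mul, Matrix.one_mul,
      Matrix.mul_one, Matrix.mul_zero, Matrix.zero_mul, s3]
    abel
  · simp only [solY, partY, projL, projR, Matrix.mul_add, Matrix.add_mul, Matrix.mul_assoc, m1, m2,
      left_mul_opN_mpInv, right_mul_opN_mpInv, s1, s2, Matrix.mul_sub, Matrix.sub_mul,
      Matrix.one_mul, Matrix.mul_one, Matrix.mul_zero, Matrix.zero_mul]
    abel

theorem twoTerm_particular {E : QTensor I K} (h : TwoTermCond A B C D E) :
    A * partX A B C D E * B + C * partY A B C D E * D = E := by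
  obtain ⟨h1, h2, h3, h4⟩ := h
  have e1 : opM A C * ((opM A C)† * E) = projR A * E := by
    rw [Matrix.mul_assoc, projR_mul_eq_zero_iff, ← Matrix.mul_assoc _ (projR A),
      opM_mpInv_mul_projR] at h1
    exact h1
  have e2 : E * ((opN B D)† * opN B D) = E * projL B := by
    rw [mul_projL_eq_zero_iff, Matrix.mul_assoc, ← Matrix.mul_assoc (projL B),
      projL_mul_opN_mpInv] at h2
    exact h2
  have e3 : projR A * E * (D† * D) = projR A * E := by
    rwa [mul_projL_eq_zero_iff] at h3
  have e4 : C * (C† * (E * projL B)) = E * projL B := by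
    rwa [Matrix.mul_assoc, projR_mul_eq_zero_iff] at h4
  have e5 : (opM A C)† * (E * (D† * D)) = (opM A C)† * E := by
    rw [← opM_mpInv_mul_projR, Matrix.mul_assoc, ← Matrix.mul_assoc (projR A), e3, ← Matrix.mul_assoc]
  have e6 : opS A C * (C† * (E * projL B)) = E * projL B - C * ((opM A C)† * (E * projL B)) := by
    conv_lhs => rw [opS, projL, Matrix.mul_sub, Matrix.sub_mul, Matrix.mul_one, e4]
    rw [Matrix.mul_assoc, Matrix.mul_assoc, ← opM_mpInv_mul_right, e4]
  have e7 : A * (A† * (C * ((opM A C)† * E))) = C * ((opM A C)† * E) - projR A * E := by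
    rw [← e1]
    simp only [opM, projR, Matrix.sub_mul, Matrix.one_mul, Matrix.mul_assoc]
    abel
  -- The part of `partX` with `N†` and the second part of `partY` add up to a multiple of `𝓛_B`.
  have e8 : opS A C * (C† * (E * ((opN B D)† * D)))
      - opS A C * (C† * (E * ((opN B D)† * (D * (B† * B)))))
        = E * projL B - C * ((opM A C)† * (E * projL B)) := by
    rw [← e6, ← e2]
    simp only [opN, projL, Matrix.mul_sub, Matrix.mul_one]
  have s1 (Z : QTensor c K) : A * (A† * (opS A C * Z)) = opS A C * Z := by
    rw [← Matrix.mul_assoc A†, ← Matrix.mul_assoc A, mul_mpInv_mul_opS]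
  have s2 (Z : QTensor c K) : C * ((opS A C)† * (opS A C * Z)) = opS A C * Z := by
    rw [← Matrix.mul_assoc (opS A C)†, ← Matrix.mul_assoc, mul_opS_mpInv_mul_opS]
  have e7' : A * (A† * (C * ((opM A C)† * (E * (B† * B)))))
      = C * ((opM A C)† * (E * (B† * B))) - projR A * (E * (B† * B)) := by
    have := congrArg (· * (B† * B)) e7
    simpa only [Matrix.sub_mul, Matrix.mul_assoc] using this
  simp only [partX, partY, Matrix.mul_sub, Matrix.sub_mul, Matrix.mul_add, Matrix.add_mul,
    Matrix.mul_assoc, e7', s1, s2, e5]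
  have e9 := sub_eq_iff_eq_add.1 e8
  rw [e9]
  simp only [projL, projR, Matrix.mul_sub, Matrix.sub_mul, Matrix.one_mul, Matrix.mul_one,
    Matrix.mul_assoc]
  abel

theorem twoTerm_homogeneous (U₁ U₂ U₃ : QTensor c d) (U₄ U₅ : QTensor a b) :
    A * (-(A† * opS A C * U₂ * projR (opN B D) * D * B†) + projL A * U₄ + U₅ * projR B) * B
      + C * (projL (opM A C) * projL (opS A C) * U₁ + projL (opM A C) * U₂ * projR (opN B D)
        + U₃ * projR D) * D = 0 := by
  have s1 (Z : QTensor c K) : A * (A† * (opS A C * Z)) = opS A C * Z := by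
    rw [← Matrix.mul_assoc A†, ← Matrix.mul_assoc A, mul_mpInv_mul_opS]
  have s2 (Z : QTensor c K) : C * (projL (opM A C) * Z) = opS A C * Z := by
    rw [← Matrix.mul_assoc, ← opS]
  have n1 : projR (opN B D) * (D * (B† * B)) = projR (opN B D) * D := by
    have h : projR (opN B D) * (D * projL B) = 0 := projR_mul_self (opN B D)
    rw [projL, Matrix.mul_sub, Matrix.mul_one, Matrix.mul_sub, sub_eq_zero] at h
    exact h.symm
  simp only [Matrix.mul_add, Matrix.add_mul, Matrix.mul_neg, Matrix.neg_mul, Matrix.mul_assoc,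
    mul_projL_cancel, projR_mul_self, s1, s2, n1, Matrix.mul_zero, add_zero, zero_add]
  exact neg_add_cancel _

/-- Solvability criterion and general solution of `A X B + C Y D = E`. -/
theorem twoTerm_iff (E : QTensor I K) (X : QTensor a b) (Y : QTensor c d) :
    A * X * B + C * Y * D = E ↔ TwoTermCond A B C D E ∧
      ∃ U₁ U₂ U₃ U₄ U₅, X = solX A B C D E U₂ U₄ U₅ ∧ Y = solY A B C D E U₁ U₂ U₃ := by
  constructor
  · exact fun h => ⟨twoTermCond_of_eq A B C D h, exists_sol_of_eq A B C D h⟩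
  · rintro ⟨h, U₁, U₂, U₃, U₄, U₅, rfl, rfl⟩
    calc _ = A * partX A B C D E * B + C * partY A B C D E * D
          + (A * (-(A† * opS A C * U₂ * projR (opN B D) * D * B†) + projL A * U₄ + U₅ * projR B) * B
            + C * (projL (opM A C) * projL (opS A C) * U₁
              + projL (opM A C) * U₂ * projR (opN B D) + U₃ * projR D) * D) := by
          simp only [solX, solY, Matrix.mul_sub, Matrix.sub_mul, Matrix.mul_add, Matrix.add_mul,
            Matrix.mul_neg, Matrix.neg_mul]
          abel
      _ = E := by
          rw [twoTerm_particular A B C D h, twoTerm_homogeneous A B C D U₁ U₂ U₃ U₄ U₅, add_zero]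

end Equations

/-! ### Block tensors -/

section Blocks

/-- The multi-index `j` in the first ranges of `J + K`. -/
def inlIndex {M : ℕ} {J K : Fin M → ℕ} (j : MultiIndex J) : MultiIndex (J + K) := fun s =>
  ⟨j s, Nat.lt_add_right _ (j s).isLt⟩

/-- The multi-index `k`, shifted into the second ranges of `J + K`. -/
def inrIndex {M : ℕ} {J K : Fin M → ℕ} (k : MultiIndex K) : MultiIndex (J + K) := fun s =>
  ⟨J s + k s, Nat.add_lt_add_left (k s).isLt _⟩

variable {N M P : ℕ} {I : Fin N → ℕ} {J K : Fin M → ℕ} {L : Fin P → ℕ}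

theorem conjTranspose_colBlock (A : QTensor J I) (B : QTensor K I) :
    (colBlock A B)ᴴ = rowBlock Aᴴ Bᴴ := by
  ext1 i l
  rw [Matrix.conjTranspose_apply, colBlock, rowBlock]
  split_ifs <;> simp

theorem conjTranspose_rowBlock (C : QTensor I J) (D : QTensor I K) :
    (rowBlock C D)ᴴ = colBlock Cᴴ Dᴴ := by
  rw [← Matrix.conjTranspose_conjTranspose (colBlock Cᴴ Dᴴ), conjTranspose_colBlock,
    Matrix.conjTranspose_conjTranspose, Matrix.conjTranspose_conjTranspose]

theorem rowBlock_inl (C : QTensor I J) (D : QTensor I K) (i : MultiIndex I) (j : MultiIndex J) :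
    rowBlock C D i (inlIndex j) = C i j :=
  dif_pos fun s => (j s).isLt

theorem rowBlock_inr (hM : 0 < M) (C : QTensor I J) (D : QTensor I K) (i : MultiIndex I)
    (k : MultiIndex K) : rowBlock C D i (inrIndex k) = D i k := by
  have h : ¬ ∀ s, ((inrIndex k : MultiIndex (J + K)) s : ℕ) < J s := fun h =>
    absurd (h ⟨0, hM⟩) (Nat.not_lt.2 (Nat.le_add_right _ _))
  have h' : ∀ s, J s ≤ ((inrIndex k : MultiIndex (J + K)) s : ℕ) := fun s => Nat.le_add_right _ _
  rw [rowBlock, dif_neg h, dif_pos h']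
  congr 1
  ext s
  simp [inrIndex]

theorem colBlock_inl (A : QTensor J I) (B : QTensor K I) (i : MultiIndex I) (j : MultiIndex J) :
    colBlock A B (inlIndex j) i = A j i :=
  dif_pos fun s => (j s).isLt

theorem colBlock_inr (hM : 0 < M) (A : QTensor J I) (B : QTensor K I) (i : MultiIndex I)
    (k : MultiIndex K) : colBlock A B (inrIndex k) i = B k i := by
  have := congrFun (congrFun (conjTranspose_colBlock A B) i) (inrIndex k)
  rw [rowBlock_inr hM] at this
  simpa using this

/-- The mixed multi-indices contribute nothing, so that block tensors multiply like block
matrices. For tensors of order zero the two ranges would not be disjoint. -/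
theorem rowBlock_mul_colBlock (hM : 0 < M) (C : QTensor I J) (D : QTensor I K)
    (A : QTensor J L) (B : QTensor K L) : rowBlock C D * colBlock A B = C * A + D * B := by
  ext1 i k
  rw [Matrix.add_apply, einstein_apply, einstein_apply, einstein_apply, ← Fintype.sum_sumElim]
  symm
  apply Fintype.sum_of_injective (Sum.elim inlIndex inrIndex)
  · apply Function.Injective.sumElim
    · intro j j' h
      ext s
      exact congrArg (fun f : MultiIndex (J + K) => (f s : ℕ)) h
    · intro j j' h
      ext s
      exact Nat.add_left_cancel (congrArg (fun f : MultiIndex (J + K) => (f s : ℕ)) h)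
    · intro j j' h
      have h0 : (j ⟨0, hM⟩ : ℕ) = J ⟨0, hM⟩ + j' ⟨0, hM⟩ :=
        congrArg (fun f : MultiIndex (J + K) => (f ⟨0, hM⟩ : ℕ)) h
      have := (j ⟨0, hM⟩).isLt
      omega
  · intro l hl
    have h : ¬ ∀ s, (l s : ℕ) < J s := fun h => hl ⟨Sum.inl fun s => ⟨l s, h s⟩, rfl⟩
    have h' : ¬ ∀ s, J s ≤ (l s : ℕ) := fun h' => hl
      ⟨Sum.inr fun s => ⟨(l s : ℕ) - J s, Nat.sub_lt_left_of_lt_add (h' s) (l s).isLt⟩, by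
        funext s
        exact Fin.ext (Nat.add_sub_of_le (h' s))⟩
    rw [rowBlock, dif_neg h, dif_neg h', zero_mul]
  · rintro (j | j)
    · simp [rowBlock_inl, colBlock_inl]
    · simp [rowBlock_inr hM, colBlock_inr hM]

theorem rowBlock_eq_add (C : QTensor I J) (D : QTensor I K) :
    rowBlock C D = C * rowBlock (1 : QTensor J J) (0 : QTensor J K)
      + D * rowBlock (0 : QTensor K J) (1 : QTensor K K) := by
  ext1 i l
  rw [Matrix.add_apply, Matrix.mul_apply, Matrix.mul_apply]
  simp only [rowBlock]
  split_ifs <;> simp [Matrix.one_apply]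

theorem colBlock_eq_add (A : QTensor J I) (B : QTensor K I) :
    colBlock A B = colBlock (1 : QTensor J J) (0 : QTensor K J) * A
      + colBlock (0 : QTensor J K) (1 : QTensor K K) * B := by
  have := congrArg Matrix.conjTranspose (rowBlock_eq_add Aᴴ Bᴴ)
  simpa [conjTranspose_rowBlock, Matrix.conjTranspose_mul] using this

end Blocks

section BlockEquation

variable {N M : ℕ} {p : Fin N → ℕ} {l : Fin M → ℕ}

/-- General solution of `A x + y D = E`: if `𝓡_A E 𝓛_D = 0`, then
`x = A† E - V D + 𝓛_A W` and `y = 𝓡_A E D† + A V + T 𝓡_D`. -/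
theorem mul_add_mul_iff {q : Fin N → ℕ} {m : Fin M → ℕ} (A : QTensor p q) (D : QTensor m l)
    (E : QTensor p l) (x : QTensor q l) (y : QTensor p m) :
    A * x + y * D = E ↔ projR A * E * projL D = 0 ∧
      ∃ (V : QTensor q m) (W : QTensor q l) (T : QTensor p m),
      x = A† * E - V * D + projL A * W ∧ y = projR A * E * D† + A * V + T * projR D := by
  constructor
  · rintro rfl
    refine ⟨?_, A† * y, x, projR A * y, ?_, ?_⟩
    · simp only [Matrix.add_mul, Matrix.mul_assoc, mul_projL_self, Matrix.mul_add,
        projR_mul_cancel, Matrix.mul_zero, Matrix.zero_mul, add_zero]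
    · simp only [projL, Matrix.sub_mul, Matrix.mul_add, Matrix.mul_assoc, Matrix.one_mul]
      abel
    · rw [Matrix.mul_add, projR_mul_cancel, zero_add]
      simp only [projR, Matrix.sub_mul, Matrix.mul_sub, Matrix.mul_assoc, Matrix.one_mul,
        Matrix.mul_one]
      abel
  · rintro ⟨h, V, W, T, rfl, rfl⟩
    rw [mul_projL_eq_zero_iff] at h
    simp only [Matrix.mul_add, Matrix.mul_sub, Matrix.add_mul, mul_projL_cancel]
    rw [Matrix.mul_assoc _ D†, h, Matrix.mul_assoc T, projR_mul_self, projR, Matrix.sub_mul]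
    simp only [Matrix.mul_assoc, Matrix.one_mul, Matrix.mul_zero]
    abel

/-- The four tensors `w₁, …, w₄` are given by the block formulas for some `V`, `W`, `T`. -/
def IsBlockSol (A : QTensor p (p + p)) (D : QTensor (l + l) l) (E w₁ w₂ w₃ w₄ : QTensor p l) :
    Prop :=
  ∃ v : BlockFree p l, w₁ = blockTop A D E v ∧ w₂ = blockBot A D E v ∧
    w₃ = blockLeft A D E v ∧ w₄ = blockRight A D E v

/-- Solvability criterion and general solution of `P w₁ + Q w₂ + w₃ R + w₄ T = E`. -/
theorem block_iff (hN : 0 < N) (hM : 0 < M) (P Q : QTensor p p) (R T : QTensor l l)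
    (E w₁ w₂ w₃ w₄ : QTensor p l) :
    P * w₁ + Q * w₂ + (w₃ * R + w₄ * T) = E ↔
      projR (rowBlock P Q) * E * projL (colBlock R T) = 0 ∧
        IsBlockSol (rowBlock P Q) (colBlock R T) E w₁ w₂ w₃ w₄ := by
  constructor
  · intro h
    rw [← rowBlock_mul_colBlock hN, ← rowBlock_mul_colBlock hM, mul_add_mul_iff] at h
    obtain ⟨h0, V, W, T', hx, hy⟩ := h
    refine ⟨h0, ⟨V, W, T'⟩, ?_, ?_, ?_, ?_⟩
    · simp [blockTop, ← hx, rowBlock_mul_colBlock hN]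
    · simp [blockBot, ← hx, rowBlock_mul_colBlock hN]
    · simp [blockLeft, ← hy, rowBlock_mul_colBlock hM]
    · simp [blockRight, ← hy, rowBlock_mul_colBlock hM]
  · rintro ⟨h0, v, rfl, rfl, rfl, rfl⟩
    simp only [blockTop, blockBot, blockLeft, blockRight]
    rw [← Matrix.mul_assoc P, ← Matrix.mul_assoc Q, ← Matrix.add_mul, ← rowBlock_eq_add,
      Matrix.mul_assoc _ _ R, Matrix.mul_assoc _ _ T, ← Matrix.mul_add, ← colBlock_eq_add,
      mul_add_mul_iff]
    exact ⟨h0, v.V, v.W, v.T, rfl, rfl⟩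

/-- The block formulas solve `P w₁ + Q w₂ + w₃ R + w₄ T = E - C U D` exactly for those `U` that
satisfy the equation left after eliminating `w₁, …, w₄`. -/
theorem block_iff_oneTerm (hN : 0 < N) (hM : 0 < M) {p' : Fin N → ℕ} {l' : Fin M → ℕ}
    (P Q : QTensor p p) (R T : QTensor l l) (E : QTensor p l) (C : QTensor p p')
    (U : QTensor p' l') (D : QTensor l' l) (w₁ w₂ w₃ w₄ : QTensor p l) :
    P * w₁ + Q * w₂ + (w₃ * R + w₄ * T) = E - C * U * D ↔
      projR (rowBlock P Q) * C * U * (D * projL (colBlock R T))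
          = projR (rowBlock P Q) * E * projL (colBlock R T) ∧
        IsBlockSol (rowBlock P Q) (colBlock R T) (E - C * U * D) w₁ w₂ w₃ w₄ := by
  rw [block_iff hN hM, Matrix.mul_sub, Matrix.sub_mul, sub_eq_zero, eq_comm]
  simp only [Matrix.mul_assoc]

/-- The analogue of `block_iff_oneTerm` for two remaining unknowns. -/
theorem block_iff_twoTerm (hN : 0 < N) (hM : 0 < M) {p' p'' : Fin N → ℕ} {l' l'' : Fin M → ℕ}
    (P Q : QTensor p p) (R T : QTensor l l) (E : QTensor p l) (F : QTensor p p')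
    (V : QTensor p' l') (G : QTensor l' l) (H : QTensor p p'') (U : QTensor p'' l'')
    (J : QTensor l'' l) (w₁ w₂ w₃ w₄ : QTensor p l) :
    P * w₁ + Q * w₂ + (w₃ * R + w₄ * T) = -E + F * V * G + H * U * J ↔
      projR (rowBlock P Q) * F * V * (G * projL (colBlock R T))
            + projR (rowBlock P Q) * H * U * (J * projL (colBlock R T))
          = projR (rowBlock P Q) * E * projL (colBlock R T) ∧
        IsBlockSol (rowBlock P Q) (colBlock R T) (-E + F * V * G + H * U * J) w₁ w₂ w₃ w₄ := by
  rw [block_iff hN hM, add_assoc, neg_add_eq_sub, Matrix.mul_sub, Matrix.sub_mul, sub_eq_zero]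
  simp only [Matrix.mul_add, Matrix.add_mul, Matrix.mul_assoc]

end BlockEquation

/-! ### Equating two expressions of an unknown -/

namespace Sys

variable {N M : ℕ} {n : Sizes N M} (S : Sys n)

/-- Equating the two expressions of `Z₁`: four parameters are given by the block formulas, and
an equation for `Û₂` remains. The other lemmas `…_eq_iff` have the same shape. -/
theorem Z₁_eq_iff (hN : 0 < N) (hM : 0 < M) (U₂ : QTensor n.p₂ n.l₂)
    (W₁ U₄ W₂ U₅ : QTensor n.p₁ n.l₁) :
    oneTermSol S.F₄ S.G₄ S.E₄ W₁ W₂ = S.e₁.solFst U₂ U₄ U₅ ↔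
      S.Ahh₁₁ * U₂ * S.Bhh₁₁ = S.Ehh₁₁ ∧ IsBlockSol S.A₁₁ S.D₁₁ (S.E₁₁ - S.Ahat₁₁ * U₂ * S.Bhat₁₁) W₁ U₄ W₂ U₅ := by
  refine Iff.trans ?_ (block_iff_oneTerm hN hM ..)
  rw [← sub_eq_zero, ← sub_eq_zero (b := S.E₁₁ - S.Ahat₁₁ * U₂ * S.Bhat₁₁)]
  refine Eq.congr ?_ rfl
  simp only [oneTermSol, Eqn.solFst, solX, E₁₁, Eqn.partFst, Ahat₁₁, Bhat₁₁, Eqn.Shat, Eqn.Nhat, Matrix.mul_assoc, Matrix.neg_mul, Matrix.mul_neg]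
  abel

theorem Z₄_eq_iff (hN : 0 < N) (hM : 0 < M) (K₂ : QTensor n.p₄ n.l₄)
    (W₁ K₁ W₃ K₃ : QTensor n.p₄ n.l₄) :
    oneTermSol S.H₄ S.J₄ S.E₅ W₁ W₃ = S.e₃.solSnd K₁ K₂ K₃ ↔
      S.Ahh₂₂ * K₂ * S.Bhh₂₂ = S.Ehh₂₂ ∧ IsBlockSol S.A₂₂ S.D₂₂ (S.E₂₂ - S.Ahat₂₂ * K₂ * S.Bhat₂₂) W₁ K₁ W₃ K₃ := by
  refine Iff.trans ?_ (block_iff_oneTerm hN hM ..)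
  rw [← sub_eq_zero, ← sub_eq_zero (b := S.E₂₂ - S.Ahat₂₂ * K₂ * S.Bhat₂₂)]
  refine Eq.congr ?_ rfl
  simp only [oneTermSol, Eqn.solSnd, solY, E₂₂, Eqn.partSnd, Ahat₂₂, Bhat₂₂, Eqn.Mhat, Eqn.Shat, Eqn.Nhat, Matrix.mul_assoc, Matrix.neg_mul, Matrix.mul_neg]
  abel

theorem Z₂_eq_iff (hN : 0 < N) (hM : 0 < M) (U₂ : QTensor n.p₂ n.l₂) (V₂ : QTensor n.p₃ n.l₃)
    (U₁ V₄ U₃ V₅ : QTensor n.p₂ n.l₂) :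
    S.e₁.solSnd U₁ U₂ U₃ = S.e₂.solFst V₂ V₄ V₅ ↔
      S.Fbar₁₁ * V₂ * S.Gbar₁₁ + S.Hbar₁₁ * U₂ * S.Jbar₁₁ = S.Ebar₁₁ ∧ IsBlockSol S.Abar₁ S.Bbar₁ (-S.Ebar₁ + S.Fbar₁ * V₂ * S.Gbar₁ + S.Hbar₁ * U₂ * S.Jbar₁) U₁ V₄ U₃ V₅ := by
  refine Iff.trans ?_ (block_iff_twoTerm hN hM ..)
  rw [eq_comm, ← sub_eq_zero, ← sub_eq_zero (b := -S.Ebar₁ + S.Fbar₁ * V₂ * S.Gbar₁ + S.Hbar₁ * U₂ * S.Jbar₁)]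
  refine Eq.congr ?_ rfl
  simp only [Eqn.solFst, Eqn.solSnd, solX, solY, Ebar₁, Fbar₁, Gbar₁, Hbar₁, Jbar₁, Eqn.partFst, Eqn.partSnd, Eqn.Mhat, Eqn.Shat, Eqn.Nhat, Matrix.mul_assoc, Matrix.neg_mul, Matrix.mul_neg]
  abel

theorem Z₃_eq_iff (hN : 0 < N) (hM : 0 < M) (V₂ : QTensor n.p₃ n.l₃) (K₂ : QTensor n.p₄ n.l₄)
    (V₁ K₄ V₃ K₅ : QTensor n.p₃ n.l₃) :
    S.e₂.solSnd V₁ V₂ V₃ = S.e₃.solFst K₂ K₄ K₅ ↔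
      S.Fbar₂₂ * K₂ * S.Gbar₂₂ + S.Hbar₂₂ * V₂ * S.Jbar₂₂ = S.Ebar₂₂ ∧ IsBlockSol S.Abar₂ S.Bbar₂ (-S.Ebar₂ + S.Fbar₂ * K₂ * S.Gbar₂ + S.Hbar₂ * V₂ * S.Jbar₂) V₁ K₄ V₃ K₅ := by
  refine Iff.trans ?_ (block_iff_twoTerm hN hM ..)
  rw [eq_comm, ← sub_eq_zero, ← sub_eq_zero (b := -S.Ebar₂ + S.Fbar₂ * K₂ * S.Gbar₂ + S.Hbar₂ * V₂ * S.Jbar₂)]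
  refine Eq.congr ?_ rfl
  simp only [Eqn.solFst, Eqn.solSnd, solX, solY, Ebar₂, Fbar₂, Gbar₂, Hbar₂, Jbar₂, Eqn.partFst, Eqn.partSnd, Eqn.Mhat, Eqn.Shat, Eqn.Nhat, Matrix.mul_assoc, Matrix.neg_mul, Matrix.mul_neg]
  abel

theorem V₂_eq_iff (hN : 0 < N) (hM : 0 < M) (P₄₄ : QTensor n.p₂ n.l₂) (Q₅₅ : QTensor n.p₃ n.l₃)
    (P₅₅ Q₇₇ P₆₆ Q₈₈ : QTensor n.p₃ n.l₃) :
    solX S.Fbar₁₁ S.Gbar₁₁ S.Hbar₁₁ S.Jbar₁₁ S.Ebar₁₁ P₄₄ P₅₅ P₆₆ = solY S.Fbar₂₂ S.Gbar₂₂ S.Hbar₂₂ S.Jbar₂₂ S.Ebar₂₂ Q₇₇ Q₅₅ Q₈₈ ↔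
      S.Fdbar₁₁ * P₄₄ * S.Gdbar₁₁ + S.Hdbar₁₁ * Q₅₅ * S.Jdbar₁₁ = S.Edbar₁₁ ∧ IsBlockSol S.Adbar₁ S.Bdbar₁ (-S.Edbar₁ + S.Fdbar₁ * P₄₄ * S.Gdbar₁ + S.Hdbar₁ * Q₅₅ * S.Jdbar₁) P₅₅ Q₇₇ P₆₆ Q₈₈ := by
  refine Iff.trans ?_ (block_iff_twoTerm hN hM ..)
  rw [← sub_eq_zero, ← sub_eq_zero (b := -S.Edbar₁ + S.Fdbar₁ * P₄₄ * S.Gdbar₁ + S.Hdbar₁ * Q₅₅ * S.Jdbar₁)]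
  refine Eq.congr ?_ rfl
  simp only [solX, solY, Edbar₁, Fdbar₁, Gdbar₁, Hdbar₁, Jdbar₁, Sbar₁₁, Nbar₁₁, Mbar₂₂, Sbar₂₂, Nbar₂₂, Matrix.mul_assoc, Matrix.neg_mul, Matrix.mul_neg]
  abel

theorem U₂_eq_iff (hN : 0 < N) (hM : 0 < M) (P₄₄ : QTensor n.p₂ n.l₂)
    (Q₄₄ V₇₇ Q₆₆ V₈₈ : QTensor n.p₂ n.l₂) :
    oneTermSol S.Ahh₁₁ S.Bhh₁₁ S.Ehh₁₁ V₇₇ V₈₈ = solY S.Fbar₁₁ S.Gbar₁₁ S.Hbar₁₁ S.Jbar₁₁ S.Ebar₁₁ Q₄₄ P₄₄ Q₆₆ ↔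
      S.Ctil₁₁ * P₄₄ * S.Dtil₁₁ = S.Etil₁₁ ∧ IsBlockSol S.Atil₁ S.Btil₁ (S.Etil₁ - S.Ctil₁ * P₄₄ * S.Dtil₁) Q₄₄ V₇₇ Q₆₆ V₈₈ := by
  refine Iff.trans ?_ (block_iff_oneTerm hN hM ..)
  rw [eq_comm, ← sub_eq_zero, ← sub_eq_zero (b := S.Etil₁ - S.Ctil₁ * P₄₄ * S.Dtil₁)]
  refine Eq.congr ?_ rfl
  simp only [oneTermSol, solY, Etil₁, Ctil₁, Dtil₁, Mbar₁₁, Sbar₁₁, Nbar₁₁, Matrix.mul_assoc, Matrix.neg_mul, Matrix.mul_neg]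
  abel

theorem K₂_eq_iff (hN : 0 < N) (hM : 0 < M) (Q₅₅ : QTensor n.p₃ n.l₃)
    (V₉₉ P₇₇ W₁₁ P₈₈ : QTensor n.p₄ n.l₄) :
    oneTermSol S.Ahh₂₂ S.Bhh₂₂ S.Ehh₂₂ V₉₉ W₁₁ = solX S.Fbar₂₂ S.Gbar₂₂ S.Hbar₂₂ S.Jbar₂₂ S.Ebar₂₂ Q₅₅ P₇₇ P₈₈ ↔
      S.Ctil₂₂ * Q₅₅ * S.Dtil₂₂ = S.Etil₂₂ ∧ IsBlockSol S.Atil₂ S.Btil₂ (S.Etil₂ - S.Ctil₂ * Q₅₅ * S.Dtil₂) V₉₉ P₇₇ W₁₁ P₈₈ := by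
  refine Iff.trans ?_ (block_iff_oneTerm hN hM ..)
  rw [← sub_eq_zero, ← sub_eq_zero (b := S.Etil₂ - S.Ctil₂ * Q₅₅ * S.Dtil₂)]
  refine Eq.congr ?_ rfl
  simp only [oneTermSol, solX, Etil₂, Ctil₂, Dtil₂, Sbar₂₂, Nbar₂₂, Matrix.mul_assoc, Matrix.neg_mul, Matrix.mul_neg]
  abel

theorem P₄₄_eq_iff (hN : 0 < N) (hM : 0 < M) (K₄₄ : QTensor n.p₃ n.l₃)
    (W₈₈ K₅₅ W₉₉ K₆₆ : QTensor n.p₂ n.l₂) :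
    oneTermSol S.Ctil₁₁ S.Dtil₁₁ S.Etil₁₁ W₈₈ W₉₉ = solX S.Fdbar₁₁ S.Gdbar₁₁ S.Hdbar₁₁ S.Jdbar₁₁ S.Edbar₁₁ K₄₄ K₅₅ K₆₆ ↔
      S.Htil₁₁ * K₄₄ * S.Jtil₁₁ = S.Edtil₁₁ ∧ IsBlockSol S.Ftil₁ S.Gtil₁ (S.Edtil₁ - S.Htil₁ * K₄₄ * S.Jtil₁) W₈₈ K₅₅ W₉₉ K₆₆ := by
  refine Iff.trans ?_ (block_iff_oneTerm hN hM ..)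
  rw [← sub_eq_zero, ← sub_eq_zero (b := S.Edtil₁ - S.Htil₁ * K₄₄ * S.Jtil₁)]
  refine Eq.congr ?_ rfl
  simp only [oneTermSol, solX, Edtil₁, Htil₁, Jtil₁, Sdbar₁₁, Ndbar₁₁, Matrix.mul_assoc, Matrix.neg_mul, Matrix.mul_neg]
  abel

theorem Q₅₅_eq_iff (hN : 0 < N) (hM : 0 < M) (K₄₄ : QTensor n.p₃ n.l₃)
    (K₇₇ T₁₁ K₈₈ T₂₂ : QTensor n.p₃ n.l₃) :
    oneTermSol S.Ctil₂₂ S.Dtil₂₂ S.Etil₂₂ T₁₁ T₂₂ = solY S.Fdbar₁₁ S.Gdbar₁₁ S.Hdbar₁₁ S.Jdbar₁₁ S.Edbar₁₁ K₇₇ K₄₄ K₈₈ ↔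
      S.Htil₂₂ * K₄₄ * S.Jtil₂₂ = S.Edtil₂₂ ∧ IsBlockSol S.Ftil₂ S.Gtil₂ (S.Edtil₂ - S.Htil₂ * K₄₄ * S.Jtil₂) K₇₇ T₁₁ K₈₈ T₂₂ := by
  refine Iff.trans ?_ (block_iff_oneTerm hN hM ..)
  rw [eq_comm, ← sub_eq_zero, ← sub_eq_zero (b := S.Edtil₂ - S.Htil₂ * K₄₄ * S.Jtil₂)]
  refine Eq.congr ?_ rfl
  simp only [oneTermSol, solY, Edtil₂, Htil₂, Jtil₂, Mdbar₁₁, Sdbar₁₁, Ndbar₁₁, Matrix.mul_assoc, Matrix.neg_mul, Matrix.mul_neg]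
  abel

theorem K₄₄_eq_iff (hN : 0 < N) (hM : 0 < M) 
    (T₃₃ T₅₅ T₄₄ T₆₆ : QTensor n.p₃ n.l₃) :
    oneTermSol S.Htil₁₁ S.Jtil₁₁ S.Edtil₁₁ T₃₃ T₄₄ = oneTermSol S.Htil₂₂ S.Jtil₂₂ S.Edtil₂₂ T₅₅ T₆₆ ↔
      projR S.Atil * S.Etil * projL S.Btil = 0 ∧ IsBlockSol S.Atil S.Btil (S.Etil) T₃₃ T₅₅ T₄₄ T₆₆ := by
  refine Iff.trans ?_ (block_iff hN hM ..)
  rw [← sub_eq_zero, ← sub_eq_zero (b := S.Etil)]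
  refine Eq.congr ?_ rfl
  simp only [oneTermSol, Etil, Matrix.neg_mul, Matrix.mul_neg]
  abel

end Sys

/-! ### A single equation of the system -/

/-- One equation of the system: eliminating `X` and `Y` leaves a two-term equation for the inner
unknowns `Z` and `Z'`. -/
theorem Eqn.holds_iff {N M : ℕ} {I a c p p' : Fin N → ℕ} {K b d l l' : Fin M → ℕ}
    (e : Eqn I a c p p' K b d l l') (X : QTensor a b) (Y : QTensor c d) (Z : QTensor p l)
    (Z' : QTensor p' l') :
    e.Holds X Y Z Z' ↔ e.Cond ∧
      (∃ u : OuterFree a c b d, X = solX e.A e.B e.C e.D (e.Edot Z Z') u.U₂ u.U₄ u.U₅ ∧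
        Y = solY e.A e.B e.C e.D (e.Edot Z Z') u.U₁ u.U₂ u.U₃) ∧
      ∃ U₁ U₂ U₃ U₄ U₅, Z = e.solFst U₂ U₄ U₅ ∧ Z' = e.solSnd U₁ U₂ U₃ := by
  have h1 : projR e.Mi * projR e.A * e.Edot Z Z' = projR e.Mi * projR e.A * e.E := by
    have h : projR e.Mi * (projR e.A * e.C) = 0 := projR_mul_self e.Mi
    rw [Eqn.Edot, Matrix.mul_sub, sub_eq_self, Matrix.mul_assoc e.C, ← Matrix.mul_assoc _ e.C,
      Matrix.mul_assoc _ (projR e.A), h, Matrix.zero_mul]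
  have h2 : e.Edot Z Z' * projL e.B * projL e.Ni = e.E * projL e.B * projL e.Ni := by
    rw [Eqn.Edot, Matrix.sub_mul, Matrix.mul_assoc _ e.B, mul_projL_self, Matrix.mul_zero, sub_zero]
  have h3 : projR e.C * e.Edot Z Z' * projL e.B = projR e.C * e.E * projL e.B := by
    rw [Eqn.Edot, Matrix.mul_sub, Matrix.mul_assoc e.C, projR_mul_cancel, sub_zero]
  have h4 : projR e.A * e.Edot Z Z' * projL e.D = 0 ↔
      e.Ahat * Z * e.Bhat + e.Chat * Z' * e.Dhat = e.Ehat := by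
    rw [Eqn.Edot, Matrix.mul_sub, Matrix.sub_mul, sub_eq_zero, eq_comm, Eqn.Ehat]
    refine Eq.congr ?_ rfl
    simp only [Eqn.Ahat, Eqn.Bhat, Eqn.Chat, Eqn.Dhat, Eqn.Mi, opM, Matrix.mul_add, Matrix.add_mul,
      Matrix.mul_assoc]
  have h5 : e.Holds X Y Z Z' ↔ e.A * X * e.B + e.C * Y * e.D = e.Edot Z Z' := by
    rw [Eqn.Holds, Eqn.Edot, eq_sub_iff_add_eq]
  rw [h5, twoTerm_iff, TwoTermCond, h3, h4, twoTerm_iff e.Ahat]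
  rw [show opM e.A e.C = e.Mi from rfl, show opN e.B e.D = e.Ni from rfl, h1, h2]
  constructor
  · rintro ⟨⟨c1, c2, ⟨c3, hZ⟩, c4⟩, U₁, U₂, U₃, U₄, U₅, hX, hY⟩
    exact ⟨⟨c1, c2, c4, c3⟩, ⟨⟨U₁, U₂, U₃, U₄, U₅⟩, hX, hY⟩, hZ⟩
  · rintro ⟨⟨c1, c2, c4, c3⟩, ⟨u, hX, hY⟩, hZ⟩
    exact ⟨⟨c1, c2, ⟨c3, hZ⟩, c4⟩, u.U₁, u.U₂, u.U₃, u.U₄, u.U₅, hX, hY⟩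

namespace Sys

/-! ### The coupled system -/

variable {N M : ℕ} {n : Sizes N M} (S : Sys n)

/-- Under the conditions each elimination step is solvable, from `K₄₄` up to the `Z_j`. -/
theorem Conditions.agree_and_solves (hN : 0 < N) (hM : 0 < M) {S : Sys n} (hS : S.Conditions)
    (f : Free n) : S.AlternativesAgree f ∧ S.Solves (S.sol f) := by
  obtain ⟨c₁, c₂, c₃, c₄, c₅, h₁, h₂, b₁, b₂, b, t₁, t₂, k₁, k₂, k⟩ := hS
  have hK : S.K₄₄ f = S.K₄₄' f :=
    (S.K₄₄_eq_iff hN hM ..).2 ⟨k, f.v_K₄₄, rfl, rfl, rfl, rfl⟩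
  have eK₁ : S.Htil₁₁ * S.K₄₄ f * S.Jtil₁₁ = S.Edtil₁₁ := (oneTerm_iff ..).2 ⟨k₁, _, _, rfl⟩
  have eK₂ : S.Htil₂₂ * S.K₄₄ f * S.Jtil₂₂ = S.Edtil₂₂ := (oneTerm_iff ..).2 ⟨k₂, _, _, hK⟩
  have hP : S.P₄₄' f = S.P₄₄ f :=
    (S.P₄₄_eq_iff hN hM ..).2 ⟨eK₁, f.v_P₄₄, rfl, rfl, rfl, rfl⟩
  have hQ : S.Q₅₅' f = S.Q₅₅ f :=
    (S.Q₅₅_eq_iff hN hM ..).2 ⟨eK₂, f.v_Q₅₅, rfl, rfl, rfl, rfl⟩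
  have eP : S.Ctil₁₁ * S.P₄₄ f * S.Dtil₁₁ = S.Etil₁₁ := (oneTerm_iff ..).2 ⟨t₁, _, _, hP.symm⟩
  have eQ : S.Ctil₂₂ * S.Q₅₅ f * S.Dtil₂₂ = S.Etil₂₂ := (oneTerm_iff ..).2 ⟨t₂, _, _, hQ.symm⟩
  have ePQ : S.Fdbar₁₁ * S.P₄₄ f * S.Gdbar₁₁ + S.Hdbar₁₁ * S.Q₅₅ f * S.Jdbar₁₁ = S.Edbar₁₁ :=
    (twoTerm_iff ..).2 ⟨b, _, _, _, _, _, rfl, rfl⟩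
  have hU : S.Uhat₂ f = S.Uhat₂' f :=
    (S.U₂_eq_iff hN hM ..).2 ⟨eP, f.v_U₂, rfl, rfl, rfl, rfl⟩
  have hV : S.Vhat₂ f = S.Vhat₂' f :=
    (S.V₂_eq_iff hN hM ..).2 ⟨ePQ, f.v_V₂, rfl, rfl, rfl, rfl⟩
  have hK₂ : S.Khat₂ f = S.Khat₂' f :=
    (S.K₂_eq_iff hN hM ..).2 ⟨eQ, f.v_K₂, rfl, rfl, rfl, rfl⟩
  have eU : S.Ahh₁₁ * S.Uhat₂ f * S.Bhh₁₁ = S.Ehh₁₁ := (oneTerm_iff ..).2 ⟨h₁, _, _, rfl⟩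
  have eK : S.Ahh₂₂ * S.Khat₂ f * S.Bhh₂₂ = S.Ehh₂₂ := (oneTerm_iff ..).2 ⟨h₂, _, _, rfl⟩
  have eVU : S.Fbar₁₁ * S.Vhat₂ f * S.Gbar₁₁ + S.Hbar₁₁ * S.Uhat₂ f * S.Jbar₁₁ = S.Ebar₁₁ :=
    (twoTerm_iff ..).2 ⟨b₁, _, _, _, _, _, rfl, hU⟩
  have eKV : S.Fbar₂₂ * S.Khat₂ f * S.Gbar₂₂ + S.Hbar₂₂ * S.Vhat₂ f * S.Jbar₂₂ = S.Ebar₂₂ :=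
    (twoTerm_iff ..).2 ⟨b₂, _, _, _, _, _, hK₂, hV⟩
  have hZ₁ : S.Z₁ f = S.Z₁' f :=
    (S.Z₁_eq_iff hN hM ..).2 ⟨eU, f.v_Z₁, rfl, rfl, rfl, rfl⟩
  have hZ₂ : S.Z₂ f = S.Z₂' f :=
    (S.Z₂_eq_iff hN hM ..).2 ⟨eVU, f.v_Z₂, rfl, rfl, rfl, rfl⟩
  have hZ₃ : S.Z₃ f = S.Z₃' f :=
    (S.Z₃_eq_iff hN hM ..).2 ⟨eKV, f.v_Z₃, rfl, rfl, rfl, rfl⟩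
  have hZ₄ : S.Z₄ f = S.Z₄' f :=
    (S.Z₄_eq_iff hN hM ..).2 ⟨eK, f.v_Z₄, rfl, rfl, rfl, rfl⟩
  refine ⟨⟨hZ₁.symm, hZ₂.symm, hZ₃.symm, hZ₄.symm, hU.symm, hV.symm, hK₂.symm, hP, hQ, hK.symm⟩,
    (oneTerm_iff ..).2 ⟨c₄, _, _, rfl⟩, ?_, ?_, ?_, (oneTerm_iff ..).2 ⟨c₅, _, _, rfl⟩⟩
  · exact (S.e₁.holds_iff ..).2 ⟨c₁, ⟨f.u₁, rfl, rfl⟩, _, _, _, _, _, hZ₁, rfl⟩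
  · exact (S.e₂.holds_iff ..).2 ⟨c₂, ⟨f.u₂, rfl, rfl⟩, _, _, _, _, _, hZ₂, rfl⟩
  · exact (S.e₃.holds_iff ..).2 ⟨c₃, ⟨f.u₃, rfl, rfl⟩, _, _, _, _, _, hZ₃, hZ₄⟩

/-- Each elimination step expresses the unknowns of one level by those of the next, from the `Z_j`
down to `K₄₄`; this yields both the conditions and the parameters. -/
theorem Solves.conditions_and_exists (hN : 0 < N) (hM : 0 < M) {S : Sys n} {u : Unknowns n}
    (hu : S.Solves u) : S.Conditions ∧ ∃ f, u = S.sol f := by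
  obtain ⟨X₁, X₂, X₃, Y₁, Y₂, Y₃, Z₁, Z₂, Z₃, Z₄⟩ := u
  obtain ⟨s₄, s₁, s₂, s₃, s₅⟩ := hu
  -- the unknowns `Z_j` in terms of `Û`, `V̂`, `K̂`
  obtain ⟨c₄, W₁, W₂, hZ₁⟩ := (oneTerm_iff ..).1 s₄
  obtain ⟨c₅, W₁', W₃, hZ₄⟩ := (oneTerm_iff ..).1 s₅
  obtain ⟨c₁, ⟨u₁, hX₁, hY₁⟩, U₁, U₂, U₃, U₄, U₅, hZ₁', hZ₂⟩ := (S.e₁.holds_iff ..).1 s₁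
  obtain ⟨c₂, ⟨u₂, hX₂, hY₂⟩, V₁, V₂, V₃, V₄, V₅, hZ₂', hZ₃⟩ := (S.e₂.holds_iff ..).1 s₂
  obtain ⟨c₃, ⟨u₃, hX₃, hY₃⟩, K₁, K₂, K₃, K₄, K₅, hZ₃', hZ₄'⟩ := (S.e₃.holds_iff ..).1 s₃
  dsimp only at hZ₁ hZ₂ hZ₃ hZ₄ hZ₁' hZ₂' hZ₃' hZ₄' hX₁ hX₂ hX₃ hY₁ hY₂ hY₃
  obtain ⟨eU, vZ₁, hW₁, hU₄, hW₂, hU₅⟩ := (S.Z₁_eq_iff hN hM ..).1 (hZ₁.symm.trans hZ₁')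
  obtain ⟨eVU, vZ₂, hU₁, hV₄, hU₃, hV₅⟩ := (S.Z₂_eq_iff hN hM ..).1 (hZ₂.symm.trans hZ₂')
  obtain ⟨eKV, vZ₃, hV₁, hK₄, hV₃, hK₅⟩ := (S.Z₃_eq_iff hN hM ..).1 (hZ₃.symm.trans hZ₃')
  obtain ⟨eK, vZ₄, hW₁', hK₁, hW₃, hK₃⟩ := (S.Z₄_eq_iff hN hM ..).1 (hZ₄.symm.trans hZ₄')
  -- `Û₂`, `V̂₂`, `K̂₂` in terms of `P` and `Q`
  obtain ⟨h₁, V₇₇, V₈₈, hU₂⟩ := (oneTerm_iff ..).1 eU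
  obtain ⟨h₂, V₉₉, W₁₁, hK₂⟩ := (oneTerm_iff ..).1 eK
  obtain ⟨b₁, Q₄₄, P₄₄, Q₆₆, P₅₅, P₆₆, hV₂, hU₂'⟩ := (twoTerm_iff ..).1 eVU
  obtain ⟨b₂, Q₇₇, Q₅₅, Q₈₈, P₇₇, P₈₈, hK₂', hV₂'⟩ := (twoTerm_iff ..).1 eKV
  obtain ⟨eP, vU₂, hQ₄₄, hV₇₇, hQ₆₆, hV₈₈⟩ := (S.U₂_eq_iff hN hM ..).1 (hU₂.symm.trans hU₂')
  obtain ⟨ePQ, vV₂, hP₅₅, hQ₇₇, hP₆₆, hQ₈₈⟩ := (S.V₂_eq_iff hN hM ..).1 (hV₂.symm.trans hV₂')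
  obtain ⟨eQ, vK₂, hV₉₉, hP₇₇, hW₁₁, hP₈₈⟩ := (S.K₂_eq_iff hN hM ..).1 (hK₂.symm.trans hK₂')
  -- `P₄₄` and `Q₅₅` in terms of `K₄₄`
  obtain ⟨b, K₇₇, K₄₄, K₈₈, K₅₅, K₆₆, hP₄₄, hQ₅₅⟩ := (twoTerm_iff ..).1 ePQ
  obtain ⟨t₁, W₈₈, W₉₉, hP₄₄'⟩ := (oneTerm_iff ..).1 eP
  obtain ⟨t₂, T₁₁, T₂₂, hQ₅₅'⟩ := (oneTerm_iff ..).1 eQ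
  obtain ⟨eK₁, vP₄₄, -, hK₅₅, -, hK₆₆⟩ := (S.P₄₄_eq_iff hN hM ..).1 (hP₄₄'.symm.trans hP₄₄)
  obtain ⟨eK₂, vQ₅₅, hK₇₇, -, hK₈₈, -⟩ := (S.Q₅₅_eq_iff hN hM ..).1 (hQ₅₅'.symm.trans hQ₅₅)
  -- `K₄₄`
  obtain ⟨k₁, T₃₃, T₄₄, hK₄₄⟩ := (oneTerm_iff ..).1 eK₁
  obtain ⟨k₂, T₅₅, T₆₆, hK₄₄'⟩ := (oneTerm_iff ..).1 eK₂
  obtain ⟨k, vK₄₄, hT₃₃, -, hT₄₄, -⟩ := (S.K₄₄_eq_iff hN hM ..).1 (hK₄₄.symm.trans hK₄₄')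
  refine ⟨⟨c₁, c₂, c₃, c₄, c₅, h₁, h₂, b₁, b₂, b, t₁, t₂, k₁, k₂, k⟩, ?_⟩
  -- With these parameters, each formula evaluates to the tensor of the same name; this is checked
  -- in the opposite order, since a formula refers to those of the lower levels.
  let f : Free n := ⟨u₁, u₂, u₃, vZ₁, vZ₂, vZ₃, vZ₄, vU₂, vV₂, vK₂, vP₄₄, vQ₅₅, vK₄₄⟩
  refine ⟨f, ?_⟩
  have fT₃₃ : S.T₃₃ f = T₃₃ := hT₃₃.symm
  have fT₄₄ : S.T₄₄ f = T₄₄ := hT₄₄.symm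
  have fK₄₄ : S.K₄₄ f = K₄₄ := by
    rw [Sys.K₄₄, fT₃₃, fT₄₄]; exact hK₄₄.symm
  have fK₅₅ : S.K₅₅ f = K₅₅ := by
    rw [Sys.K₅₅, Sys.rhsP₄₄, fK₄₄]; exact hK₅₅.symm
  have fK₆₆ : S.K₆₆ f = K₆₆ := by
    rw [Sys.K₆₆, Sys.rhsP₄₄, fK₄₄]; exact hK₆₆.symm
  have fK₇₇ : S.K₇₇ f = K₇₇ := by
    rw [Sys.K₇₇, Sys.rhsQ₅₅, fK₄₄]; exact hK₇₇.symm
  have fK₈₈ : S.K₈₈ f = K₈₈ := by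
    rw [Sys.K₈₈, Sys.rhsQ₅₅, fK₄₄]; exact hK₈₈.symm
  have fP₄₄ : S.P₄₄ f = P₄₄ := by
    rw [Sys.P₄₄, fK₄₄, fK₅₅, fK₆₆]; exact hP₄₄.symm
  have fQ₅₅ : S.Q₅₅ f = Q₅₅ := by
    rw [Sys.Q₅₅, fK₇₇, fK₄₄, fK₈₈]; exact hQ₅₅.symm
  have fV₇₇ : S.V₇₇ f = V₇₇ := by
    rw [Sys.V₇₇, Sys.rhsU₂, fP₄₄]; exact hV₇₇.symm
  have fV₈₈ : S.V₈₈ f = V₈₈ := by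
    rw [Sys.V₈₈, Sys.rhsU₂, fP₄₄]; exact hV₈₈.symm
  have fV₉₉ : S.V₉₉ f = V₉₉ := by
    rw [Sys.V₉₉, Sys.rhsK₂, fQ₅₅]; exact hV₉₉.symm
  have fW₁₁ : S.W₁₁ f = W₁₁ := by
    rw [Sys.W₁₁, Sys.rhsK₂, fQ₅₅]; exact hW₁₁.symm
  have fP₅₅ : S.P₅₅ f = P₅₅ := by
    rw [Sys.P₅₅, Sys.rhsV₂, fP₄₄, fQ₅₅]; exact hP₅₅.symm
  have fP₆₆ : S.P₆₆ f = P₆₆ := by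
    rw [Sys.P₆₆, Sys.rhsV₂, fP₄₄, fQ₅₅]; exact hP₆₆.symm
  have fU₂ : S.Uhat₂ f = U₂ := by
    rw [Sys.Uhat₂, fV₇₇, fV₈₈]; exact hU₂.symm
  have fK₂ : S.Khat₂ f = K₂ := by
    rw [Sys.Khat₂, fV₉₉, fW₁₁]; exact hK₂.symm
  have fV₂ : S.Vhat₂ f = V₂ := by
    rw [Sys.Vhat₂, fP₄₄, fP₅₅, fP₆₆]; exact hV₂.symm
  have fW₁ : S.W₁ f = W₁ := by
    rw [Sys.W₁, Sys.rhsZ₁, fU₂]; exact hW₁.symm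
  have fW₂ : S.W₂ f = W₂ := by
    rw [Sys.W₂, Sys.rhsZ₁, fU₂]; exact hW₂.symm
  have fU₁ : S.Uhat₁ f = U₁ := by
    rw [Sys.Uhat₁, Sys.rhsZ₂, fV₂, fU₂]; exact hU₁.symm
  have fU₃ : S.Uhat₃ f = U₃ := by
    rw [Sys.Uhat₃, Sys.rhsZ₂, fV₂, fU₂]; exact hU₃.symm
  have fV₁ : S.Vhat₁ f = V₁ := by
    rw [Sys.Vhat₁, Sys.rhsZ₃, fK₂, fV₂]; exact hV₁.symm
  have fV₃ : S.Vhat₃ f = V₃ := by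
    rw [Sys.Vhat₃, Sys.rhsZ₃, fK₂, fV₂]; exact hV₃.symm
  have fW₁' : S.What₁ f = W₁' := by
    rw [Sys.What₁, Sys.rhsZ₄, fK₂]; exact hW₁'.symm
  have fW₃ : S.W₃ f = W₃ := by
    rw [Sys.W₃, Sys.rhsZ₄, fK₂]; exact hW₃.symm
  have fZ₁ : S.Z₁ f = Z₁ := by
    rw [Sys.Z₁, fW₁, fW₂]; exact hZ₁.symm
  have fZ₂ : S.Z₂ f = Z₂ := by
    rw [Sys.Z₂, fU₁, fU₂, fU₃]; exact hZ₂.symm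
  have fZ₃ : S.Z₃ f = Z₃ := by
    rw [Sys.Z₃, fV₁, fV₂, fV₃]; exact hZ₃.symm
  have fZ₄ : S.Z₄ f = Z₄ := by
    rw [Sys.Z₄, fW₁', fW₃]; exact hZ₄.symm
  rw [Sys.sol, fZ₁, fZ₂, fZ₃, fZ₄]
  exact Unknowns.mk.injEq .. ▸ ⟨hX₁, hX₂, hX₃, hY₁, hY₂, hY₃, rfl, rfl, rfl, rfl⟩

end Sys

end QT

theorem theorem3p1 {N M : ℕ} (hN : 0 < N) (hM : 0 < M) {n : QT.Sizes N M} (S : QT.Sys n) :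
    ((∃ u : QT.Unknowns n, S.Solves u) ↔ S.Conditions) ∧
    (S.Conditions →
      (∀ u : QT.Unknowns n, S.Solves u ↔ ∃ f : QT.Free n, u = S.sol f) ∧
      ∀ f : QT.Free n, S.AlternativesAgree f) := by
  have key (hS : S.Conditions) (f : QT.Free n) := hS.agree_and_solves hN hM f
  refine ⟨⟨fun ⟨u, hu⟩ => (hu.conditions_and_exists hN hM).1, fun hS => ?_⟩, fun hS =>
    ⟨fun u => ⟨fun hu => (hu.conditions_and_exists hN hM).2, ?_⟩, fun f => (key hS f).1⟩⟩
  · have o {a c : Fin N → ℕ} {b d : Fin M → ℕ} : QT.OuterFree a c b d := ⟨0, 0, 0, 0, 0⟩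
    have v {p : Fin N → ℕ} {l : Fin M → ℕ} : QT.BlockFree p l := ⟨0, 0, 0⟩
    exact ⟨_, (key hS ⟨o, o, o, v, v, v, v, v, v, v, v, v, v⟩).2⟩
  · rintro ⟨f, rfl⟩
    exact (key hS f).2
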